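/- Let $p$ be a prime and $n\ge 1$. Write $P[y_1,\dots,y_n]$ for the polynomial algebra and $E(x_1,\dots,x_n)$ for the exterior algebra over $\mathbb Z/p$; the group $GL_n=GL_n(\mathbb Z/p)$ acts on both by linear substitution of the generators. The reduced powers $P^k$ act on $P[y_1,\dots,y_n]$ by the rule that $\sum_k P^k\,T^k$ is multiplicative with $y_i\mapsto y_i+y_i^pT$; on $E(x_1,\dots,x_n)\otimes P[y_1,\dots,y_n]$ they act in the same way on the second factor and trivially on the first ($P^0=1$, $P^kx_i=0$ for $k\ge1$), and the Bockstein $\beta$ is the signed derivation with $\beta x_i=y_i$, $\beta y_i=0$. A module is called indecomposable if it is nonzero and its only direct summands are $0$ and the whole module (submodules are not required to be graded). (a) Let $p$ be odd, let $\mathcal A$ be the mod $p$ Steenrod algebra (generated by $\beta$ and the $P^k$), and let $$D_n=\bigl(E(x_1,\dots,x_n)\otimes P[y_1,\dots,y_n]\bigr)^{GL_n}$$ be the extended Dickson algebra, the algebra of $GL_n$-invariants of $H^*(B(\mathbb Z/p)^n;\mathbb Z/p)$. Then the augmentation ideal $\overline{D_n}$ (the invariants with zero constant term) is indecomposable as an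 $\mathcal A$-module. (b) For every prime $p$, the augmentation ideal of the classical Dickson algebra $P[y_1,\dots,y_n]^{GL_n}$ is indecomposable as a module over the algebra generated by the reduced powers $P^k$. For $p=2$ one has $P^k=Sq^k$, this algebra is the mod $2$ Steenrod algebra $\mathcal A$, and $P[y_1,\dots,y_n]^{GL_n}=H^*(B(\mathbb Z/2)^n;\mathbb Z/2)^{GL_n}$ is the Dickson algebra $D_n$; so (b) says that $\overline{D_n}$ is indecomposable as an $\mathcal A$-module in this case too. -/

import Mathlib

open scoped TensorProduct

noncomputable section

namespace Dickson

/-! ### Generalities: algebras of natural operations, indecomposable modules -/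

/-- The algebra of operations on the family `H 0, H 1, …` generated by a set `s` of operations;
an operation is a family of linear endomorphisms, one of each `H n`, and the product is
composition. -/
def OperationAlgebra (F : Type) [Field F] (H : ℕ → Type) [∀ n, AddCommGroup (H n)]
    [∀ n, Module F (H n)] (s : Set (∀ n, Module.End F (H n))) : Type :=
  Algebra.adjoin F s

instance (F : Type) [Field F] (H : ℕ → Type) [∀ n, AddCommGroup (H n)] [∀ n, Module F (H n)]
    (s : Set (∀ n, Module.End F (H n))) : Ring (OperationAlgebra F H s) :=
  inferInstanceAs (Ring (Algebra.adjoin F s))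

instance (F : Type) [Field F] (H : ℕ → Type) [∀ n, AddCommGroup (H n)] [∀ n, Module F (H n)]
    (s : Set (∀ n, Module.End F (H n))) : Algebra F (OperationAlgebra F H s) :=
  inferInstanceAs (Algebra F (Algebra.adjoin F s))

/-- An operation acts on `H n` through its `n`-th component. -/
@[reducible] def OperationAlgebra.module {F : Type} [Field F] {H : ℕ → Type}
    [∀ n, AddCommGroup (H n)] [∀ n, Module F (H n)] (s : Set (∀ n, Module.End F (H n))) (n : ℕ) :
    Module (OperationAlgebra F H s) (H n) :=
  Module.compHom (H n)
    ((Pi.evalRingHom (fun n => Module.End F (H n)) n).comp (Algebra.adjoin F s).val.toRingHom)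

/-- A subspace stable under the generating operations is stable under all operations. -/
theorem OperationAlgebra.stable {F : Type} [Field F] {H : ℕ → Type}
    [∀ n, AddCommGroup (H n)] [∀ n, Module F (H n)] {s : Set (∀ n, Module.End F (H n))} {n : ℕ}
    (W : Submodule F (H n)) (hW : ∀ θ ∈ s, ∀ h ∈ W, θ n h ∈ W)
    (a : OperationAlgebra F H s) : ∀ h ∈ W, a.1 n h ∈ W := by
  obtain ⟨a, ha⟩ := a
  induction ha using Algebra.adjoin_induction with
  | mem θ hθ => exact hW θ hθ
  | algebraMap r =>
    intro h hh
    exact W.smul_mem r hh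
  | add x y _ _ hx hy =>
    intro h hh
    exact W.add_mem (hx h hh) (hy h hh)
  | mul x y _ _ hx hy =>
    intro h hh
    exact hx _ (hy h hh)

/-- A module is (directly) indecomposable if it is nonzero and its only direct summands are zero
and the whole module. -/
def IsIndecomposable (R M : Type) [Ring R] [AddCommGroup M] [Module R M] : Prop :=
  Nontrivial M ∧ ∀ N N' : Submodule R M, IsCompl N N' → N = ⊥ ∨ N = ⊤

variable (p : ℕ) [Fact p.Prime]

/-! ### The polynomial algebra `P[y₁, …, yₙ]` over `ℤ/p` -/

/-- The polynomial algebra `P[y₁, …, yₙ]` over `ℤ/p`, `yᵢ = X i`. The generators have degree `2` if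
`p` is odd and degree `1` if `p = 2`; for `p = 2` this is the cohomology algebra `H^*(BVⁿ; ℤ/2)`. -/
abbrev Poly (n : ℕ) : Type := MvPolynomial (Fin n) (ZMod p)

/-- The total reduced power `f ↦ ∑ₖ Pᵏ(f) Tᵏ`: the multiplicative (Cartan formula) map with
`yᵢ ↦ yᵢ + yᵢ^p T`. -/
def totalPower (n : ℕ) : Poly p n →ₐ[ZMod p] Polynomial (Poly p n) :=
  MvPolynomial.aeval fun i =>
    Polynomial.C (MvPolynomial.X i) + Polynomial.C (MvPolynomial.X i ^ p) * Polynomial.X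

/-- The reduced power `Pᵏ` on `P[y₁, …, yₙ]`; for `p = 2` it is the Steenrod square `Sqᵏ`. -/
def polyPower (k n : ℕ) : Module.End (ZMod p) (Poly p n) :=
  ((Polynomial.lcoeff (Poly p n) k).restrictScalars (ZMod p)).comp (totalPower p n).toLinearMap

/-- Linear substitution `yⱼ ↦ ∑ᵢ gᵢⱼ yᵢ`. -/
def polyAct {n : ℕ} (g : Matrix (Fin n) (Fin n) (ZMod p)) : Poly p n →ₐ[ZMod p] Poly p n :=
  MvPolynomial.aeval fun j => ∑ i, g i j • MvPolynomial.X i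

/-- The augmentation `yᵢ ↦ 0`. -/
def polyAug (n : ℕ) : Poly p n →ₐ[ZMod p] ZMod p :=
  MvPolynomial.aeval fun _ => 0

/-- The classical Dickson algebra `P[y₁, …, yₙ]^{GLₙ}`. -/
def ClassicalDickson (n : ℕ) : Subalgebra (ZMod p) (Poly p n) :=
  ⨅ g : GL (Fin n) (ZMod p), AlgHom.equalizer (polyAct p g.1) (AlgHom.id _ _)

/-- The algebra of reduced powers, realized as an algebra of operations on the polynomial algebras
`P[y₁, …, yₙ]`, `n ≥ 0`, on which it is faithfully represented. For `p = 2` it is the mod `2`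
Steenrod algebra, generated by the `Sqᵏ`. -/
abbrev ReducedPowerAlgebra : Type :=
  OperationAlgebra (ZMod p) (Poly p) (Set.range (polyPower p))

instance (n : ℕ) : Module (ReducedPowerAlgebra p) (Poly p n) :=
  OperationAlgebra.module _ n

theorem mem_classicalDickson {n : ℕ} {f : Poly p n} :
    f ∈ ClassicalDickson p n ↔ ∀ g : GL (Fin n) (ZMod p), polyAct p g.1 f = f := by
  simp [ClassicalDickson, Algebra.mem_iInf]

theorem totalPower_polyAct {n : ℕ} (g : Matrix (Fin n) (Fin n) (ZMod p)) (f : Poly p n) :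
    totalPower p n (polyAct p g f) =
      Polynomial.mapAlgHom (polyAct p g) (totalPower p n f) := by
  have key : (totalPower p n).comp (polyAct p g) =
      (Polynomial.mapAlgHom (polyAct p g)).comp (totalPower p n) := by
    refine MvPolynomial.algHom_ext fun j => ?_
    have hfrob : (∑ i, g i j • (MvPolynomial.X i : Poly p n)) ^ p =
        ∑ i, g i j • (MvPolynomial.X i : Poly p n) ^ p := by
      rw [sum_pow_char]
      refine Finset.sum_congr rfl fun i _ => ?_
      rw [smul_pow, ZMod.pow_card]
    simp only [AlgHom.comp_apply, polyAct, totalPower, MvPolynomial.aeval_X, map_sum, map_smul,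
      map_add, map_mul, map_pow, Polynomial.coe_mapAlgHom, Polynomial.map_C, Polynomial.map_X,
      RingHom.coe_coe]
    rw [← map_sum Polynomial.C, ← map_pow Polynomial.C, hfrob, map_sum, map_sum, Finset.sum_mul,
      ← Finset.sum_add_distrib]
    refine Finset.sum_congr rfl fun i _ => ?_
    rw [smul_add, ← Polynomial.smul_C, ← Polynomial.smul_C, smul_mul_assoc, map_pow]
  exact DFunLike.congr_fun key f

theorem polyPower_polyAct {n : ℕ} (k : ℕ) (g : Matrix (Fin n) (Fin n) (ZMod p)) (f : Poly p n) :
    polyPower p k n (polyAct p g f) = polyAct p g (polyPower p k n f) := by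
  change (totalPower p n (polyAct p g f)).coeff k = polyAct p g ((totalPower p n f).coeff k)
  rw [totalPower_polyAct]
  simp

theorem polyAug_polyPower {n : ℕ} (k : ℕ) (f : Poly p n) :
    polyAug p n (polyPower p k n f) = if k = 0 then polyAug p n f else 0 := by
  have key : (Polynomial.mapAlgHom (polyAug p n)).comp (totalPower p n) =
      (Algebra.ofId (ZMod p) (Polynomial (ZMod p))).comp (polyAug p n) := by
    refine MvPolynomial.algHom_ext fun j => ?_
    simp [totalPower, polyAug, (Fact.out : p.Prime).ne_zero]
  have h := congrArg (fun q => Polynomial.coeff q k) (DFunLike.congr_fun key f)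
  change polyAug p n ((totalPower p n f).coeff k) = _
  simpa [Algebra.ofId_apply, Polynomial.coeff_C] using h

/-- The augmentation ideal of the classical Dickson algebra, as a module over the algebra of
reduced powers. -/
def classicalAugmentationIdeal (n : ℕ) : Submodule (ReducedPowerAlgebra p) (Poly p n) where
  carrier := {f | f ∈ ClassicalDickson p n ∧ polyAug p n f = 0}
  add_mem' := fun {f g} hf hg => ⟨add_mem hf.1 hg.1, by rw [map_add, hf.2, hg.2, add_zero]⟩
  zero_mem' := ⟨zero_mem _, map_zero _⟩
  smul_mem' := fun a f hf => by
    refine OperationAlgebra.stable (n := n)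
      (Subalgebra.toSubmodule (ClassicalDickson p n) ⊓ LinearMap.ker (polyAug p n).toLinearMap)
      ?_ a f hf
    rintro _ ⟨k, rfl⟩ h ⟨h₁, h₂⟩
    refine ⟨(mem_classicalDickson p).2 fun g => ?_, ?_⟩
    · rw [← polyPower_polyAct, (mem_classicalDickson p).1 h₁ g]
    · have h₂' : polyAug p n h = 0 := h₂
      change polyAug p n (polyPower p k n h) = 0
      rw [polyAug_polyPower, h₂', ite_self]

/-! ### The algebra `E(x₁, …, xₙ) ⊗ P[y₁, …, yₙ]` for odd `p` -/

/-- The exterior algebra `E(x₁, …, xₙ)` over `ℤ/p`, with `xᵢ` the `i`-th standard basis vector. -/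
abbrev Ext (n : ℕ) : Type := ExteriorAlgebra (ZMod p) (Fin n → ZMod p)

/-- `E(x₁, …, xₙ) ⊗ P[y₁, …, yₙ]`, with `|xᵢ| = 1` and `|yᵢ| = 2`: for odd `p` this is the
cohomology algebra `H^*(BVⁿ; ℤ/p)`. The signs in the product of a graded tensor product are
trivial since the second factor is concentrated in even degrees. -/
abbrev Coh (n : ℕ) : Type := Ext p n ⊗[ZMod p] Poly p n

/-- The reduced power `Pᵏ` on `E ⊗ P`. By the Cartan formula, and since `P⁰ = 1` and `Pᵏ xᵢ = 0`
for `k ≥ 1`, it is the identity of `E` tensored with `Pᵏ` on `P`. -/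
def power (k n : ℕ) : Module.End (ZMod p) (Coh p n) :=
  LinearMap.lTensor (Ext p n) (polyPower p k n)

/-- The Bockstein on `E ⊗ P`, the derivation (with signs) with `β xᵢ = yᵢ` and `β yᵢ = 0`:
it is the sum over `i` of the signed derivation of `E` with `xⱼ ↦ δᵢⱼ`, tensored with
multiplication by `yᵢ`. -/
def bockstein (n : ℕ) : Module.End (ZMod p) (Coh p n) :=
  ∑ i, TensorProduct.map
    (CliffordAlgebra.contractLeft (Q := (0 : QuadraticForm (ZMod p) (Fin n → ZMod p)))
      (LinearMap.proj i))
    (LinearMap.mulLeft (ZMod p) (MvPolynomial.X i : Poly p n))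

/-- The linear substitution `xⱼ ↦ ∑ᵢ gᵢⱼ xᵢ`, `yⱼ ↦ ∑ᵢ gᵢⱼ yᵢ`. -/
def act {n : ℕ} (g : Matrix (Fin n) (Fin n) (ZMod p)) : Coh p n →ₐ[ZMod p] Coh p n :=
  Algebra.TensorProduct.map (ExteriorAlgebra.map g.mulVecLin) (polyAct p g)

/-- The augmentation `xᵢ ↦ 0`, `yᵢ ↦ 0`. -/
def aug (n : ℕ) : Coh p n →ₐ[ZMod p] ZMod p :=
  (Algebra.TensorProduct.lmul' (ZMod p)).comp
    (Algebra.TensorProduct.map ExteriorAlgebra.algebraMapInv (polyAug p n))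

/-- The extended Dickson algebra `Dₙ = (E(x₁, …, xₙ) ⊗ P[y₁, …, yₙ])^{GLₙ}`. -/
def ExtendedDickson (n : ℕ) : Subalgebra (ZMod p) (Coh p n) :=
  ⨅ g : GL (Fin n) (ZMod p), AlgHom.equalizer (act p g.1) (AlgHom.id _ _)

/-- The mod `p` Steenrod algebra for odd `p`, generated by `β` and the `Pᵏ`, realized as an algebra
of operations on the cohomology algebras `H^*(BVⁿ; ℤ/p)`, `n ≥ 0`, on which it is faithfully
represented. -/
abbrev SteenrodAlgebra : Type :=
  OperationAlgebra (ZMod p) (Coh p) (insert (bockstein p) (Set.range (power p)))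

instance (n : ℕ) : Module (SteenrodAlgebra p) (Coh p n) :=
  OperationAlgebra.module _ n

theorem mem_extendedDickson {n : ℕ} {f : Coh p n} :
    f ∈ ExtendedDickson p n ↔ ∀ g : GL (Fin n) (ZMod p), act p g.1 f = f := by
  simp [ExtendedDickson, Algebra.mem_iInf]

theorem power_act {n : ℕ} (k : ℕ) (g : Matrix (Fin n) (Fin n) (ZMod p)) (f : Coh p n) :
    power p k n (act p g f) = act p g (power p k n f) := by
  induction f using TensorProduct.induction_on with
  | zero => simp
  | tmul e f => simp [power, act, polyPower_polyAct]
  | add x y hx hy => simp only [map_add, hx, hy]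

theorem contractLeft_map {n : ℕ} (g : Matrix (Fin n) (Fin n) (ZMod p))
    (d : Module.Dual (ZMod p) (Fin n → ZMod p)) (e : Ext p n) :
    CliffordAlgebra.contractLeft (Q := (0 : QuadraticForm (ZMod p) (Fin n → ZMod p))) d
        (ExteriorAlgebra.map g.mulVecLin e) =
      ExteriorAlgebra.map g.mulVecLin
        (CliffordAlgebra.contractLeft (Q := (0 : QuadraticForm (ZMod p) (Fin n → ZMod p)))
          (d.comp g.mulVecLin) e) := by
  induction e using CliffordAlgebra.left_induction with
  | algebraMap r => simp
  | add x y hx hy => simp only [map_add, hx, hy]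
  | ι_mul x m hx =>
    have h1 : ExteriorAlgebra.map g.mulVecLin
        (CliffordAlgebra.ι (0 : QuadraticForm (ZMod p) (Fin n → ZMod p)) m) =
        CliffordAlgebra.ι (0 : QuadraticForm (ZMod p) (Fin n → ZMod p)) (g.mulVecLin m) :=
      ExteriorAlgebra.map_apply_ι _ _
    rw [map_mul, h1, CliffordAlgebra.contractLeft_ι_mul, hx, CliffordAlgebra.contractLeft_ι_mul,
      map_sub, map_smul, map_mul, h1]
    rfl

theorem bockstein_act {n : ℕ} (g : Matrix (Fin n) (Fin n) (ZMod p)) (f : Coh p n) :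
    bockstein p n (act p g f) = act p g (bockstein p n f) := by
  induction f using TensorProduct.induction_on with
  | zero => simp
  | add x y hx hy => simp only [map_add, hx, hy]
  | tmul e f =>
    have hd : ∀ i : Fin n, (LinearMap.proj i : Module.Dual (ZMod p) (Fin n → ZMod p)).comp
        g.mulVecLin = ∑ j, g i j • LinearMap.proj j := by
      intro i
      ext j
      simp [Pi.single_apply]
    simp only [bockstein, act, LinearMap.sum_apply, TensorProduct.map_tmul,
      Algebra.TensorProduct.map_tmul, contractLeft_map, hd, map_sum, map_smul,
      LinearMap.smul_apply, LinearMap.mulLeft_apply, map_mul, TensorProduct.sum_tmul]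
    rw [Finset.sum_comm]
    refine Finset.sum_congr rfl fun j _ => ?_
    simp only [polyAct, MvPolynomial.aeval_X, Finset.sum_mul, TensorProduct.tmul_sum,
      smul_mul_assoc, TensorProduct.tmul_smul, TensorProduct.smul_tmul']

theorem aug_power {n : ℕ} (k : ℕ) (f : Coh p n) :
    aug p n (power p k n f) = if k = 0 then aug p n f else 0 := by
  induction f using TensorProduct.induction_on with
  | zero => simp
  | tmul e f =>
    simp only [power, aug, LinearMap.lTensor_tmul, AlgHom.comp_apply,
      Algebra.TensorProduct.map_tmul, Algebra.TensorProduct.lmul'_apply_tmul, polyAug_polyPower]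
    split_ifs <;> simp
  | add x y hx hy =>
    simp only [map_add, hx, hy]
    split_ifs <;> simp

theorem aug_bockstein {n : ℕ} (f : Coh p n) : aug p n (bockstein p n f) = 0 := by
  induction f using TensorProduct.induction_on with
  | zero => simp
  | tmul e f => simp [bockstein, aug, polyAug]
  | add x y hx hy => simp only [map_add, hx, hy, add_zero]

/-- The augmentation ideal of the extended Dickson algebra `Dₙ`, as a module over the Steenrod
algebra. -/
def extendedAugmentationIdeal (n : ℕ) : Submodule (SteenrodAlgebra p) (Coh p n) where
  carrier := {f | f ∈ ExtendedDickson p n ∧ aug p n f = 0}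
  add_mem' := fun {f g} hf hg => ⟨add_mem hf.1 hg.1, by rw [map_add, hf.2, hg.2, add_zero]⟩
  zero_mem' := ⟨zero_mem _, map_zero _⟩
  smul_mem' := fun a f hf => by
    refine OperationAlgebra.stable (n := n)
      (Subalgebra.toSubmodule (ExtendedDickson p n) ⊓ LinearMap.ker (aug p n).toLinearMap)
      ?_ a f hf
    rintro _ (rfl | ⟨k, rfl⟩) h ⟨h₁, h₂⟩
    · refine ⟨(mem_extendedDickson p).2 fun g => ?_, aug_bockstein p h⟩
      rw [← bockstein_act, (mem_extendedDickson p).1 h₁ g]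
    · refine ⟨(mem_extendedDickson p).2 fun g => ?_, ?_⟩
      · rw [← power_act, (mem_extendedDickson p).1 h₁ g]
      · have h₂' : aug p n h = 0 := h₂
        change aug p n (power p k n h) = 0
        rw [aug_power, h₂', ite_self]

end Dickson

end

/-!
Write `E` for the top Dickson class, the `(p - 1)`-st power of the Moore determinant
`det (yⱼ^(pⁱ))`. Every nonzero submodule of either augmentation ideal contains `E^(p^k)` for all
large `k`, so two such submodules never intersect trivially.

In the polynomial case, let a subspace of the augmentation ideal be stable under the `P^k`. With
`f` it contains `P^(deg f) f`, the `p`-th power of the leading form of `f`, so after passing to the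
subspace of `p`-th roots we may start from a homogeneous invariant. The primitives `yⱼ ↦ yⱼ^(pⁱ)`
with `1 ≤ i < n` kill `E`, and they map an invariant `g` to `E * q` with `deg q < deg g`, because
their values on invariants are divisible by every linear form. They thus replace `E^a * g` by
`E^(a+1) * q`, until they all kill `g`; then `g = E^b * h^p`, and the primitive with `i = n`, which
sends `E` to `±E²`, raises the exponent of `E` to a multiple of `p`. Now pass to `p`-th roots again.

In the exterior case the Milnor operations `Qᵢ` anticommute and have square zero, so every nonzero
submodule contains a nonzero element killed by `Q₀, …, Qₙ₋₁`. Since the Moore determinant is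
nonzero, such an element is killed by all contractions, hence lies in the polynomial part.
-/

open scoped TensorProduct
open MvPolynomial

noncomputable section

namespace Dickson

section Polynomials

variable {σ R : Type*} [CommRing R]

theorem exists_eq_C_mul_of_dvd_of_totalDegree_le [IsDomain R] {f g : MvPolynomial σ R}
    (hdvd : f ∣ g) (hdeg : g.totalDegree ≤ f.totalDegree) : ∃ c : R, g = C c * f := by
  obtain ⟨q, rfl⟩ := hdvd
  rcases eq_or_ne (f * q) 0 with h0 | h0
  · exact ⟨0, by simp [h0]⟩
  · rw [totalDegree_mul_of_isDomain (left_ne_zero_of_mul h0) (right_ne_zero_of_mul h0)] at hdeg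
    exact ⟨q.coeff 0, by rw [← totalDegree_eq_zero_iff_eq_C.1 (by omega), mul_comm]⟩

theorem homogeneousComponent_totalDegree_ne_zero {f : MvPolynomial σ R} (hf : f ≠ 0) :
    homogeneousComponent f.totalDegree f ≠ 0 := by
  obtain ⟨s, hs, (hdeg : f.totalDegree = s.degree)⟩ :=
    Finset.exists_mem_eq_sup f.support (support_nonempty.2 hf) fun s => s.degree
  intro h
  apply mem_support_iff.1 hs
  have hcoeff := congrArg (coeff s) h
  rwa [coeff_homogeneousComponent, if_pos hdeg.symm, coeff_zero] at hcoeff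

theorem order_le_totalDegree {f : MvPolynomial σ R} (hf : f ≠ 0) :
    (f : MvPowerSeries σ R).order ≤ f.totalDegree := by
  obtain ⟨s, hs⟩ := support_nonempty.2 hf
  exact (MvPowerSeries.order_le (by simpa using hs)).trans (mod_cast le_totalDegree hs)

theorem isHomogeneous_totalDegree_iff {f : MvPolynomial σ R} :
    f.IsHomogeneous f.totalDegree ↔ f.totalDegree ≤ (f : MvPowerSeries σ R).order := by
  constructor
  · intro h
    refine MvPowerSeries.le_order fun s hs => ?_
    rw [coeff_coe]
    exact h.coeff_eq_zero (mod_cast hs.ne)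
  · intro h s hs
    have hle := MvPowerSeries.order_le (f := (f : MvPowerSeries σ R)) (d := s) (by simpa using hs)
    rw [Pi.one_def, ← Finsupp.degree_eq_weight_one]
    exact le_antisymm (le_totalDegree (mem_support_iff.2 hs)) (mod_cast h.trans hle)

theorem isHomogeneous_of_dvd [IsDomain R] {f g : MvPolynomial σ R} {m : ℕ}
    (hg : g.IsHomogeneous m) (hg0 : g ≠ 0) (hfg : f ∣ g) : f.IsHomogeneous f.totalDegree := by
  obtain rfl := hg.totalDegree hg0
  obtain ⟨q, rfl⟩ := hfg
  have hf0 := left_ne_zero_of_mul hg0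
  have hq0 := right_ne_zero_of_mul hg0
  rw [isHomogeneous_totalDegree_iff, coe_mul, MvPowerSeries.order_mul,
    totalDegree_mul_of_isDomain hf0 hq0, Nat.cast_add] at hg
  refine isHomogeneous_totalDegree_iff.2 ((ENat.add_le_add_iff_right
    (ENat.natCast_ne_top q.totalDegree)).1 ?_)
  exact hg.trans (add_le_add_right (order_le_totalDegree hq0) _)

theorem sq_dvd_aeval_add_single_sub [DecidableEq σ] (j : σ) (a f : MvPolynomial σ R) :
    a ^ 2 ∣ aeval (X + Pi.single j a) f - f - a * pderiv j f := by
  induction f using MvPolynomial.induction_on with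
  | C r => simp
  | add f g hf hg =>
    convert dvd_add hf hg using 1
    simp only [map_add]
    ring
  | mul_X f i hf =>
    have hfirst : a ∣ aeval (X + Pi.single j a) f - f := by
      have := dvd_add ((dvd_pow_self a two_ne_zero).trans hf) (dvd_mul_right a (pderiv j f))
      rwa [sub_add_cancel] at this
    convert dvd_add (hf.mul_right (X i))
      ((sq a ▸ mul_dvd_mul_left a hfirst).mul_right
        ((Pi.single j 1 : σ → MvPolynomial σ R) i)) using 1
    have hsingle : (Pi.single j a : σ → MvPolynomial σ R) i =
        a * (Pi.single j 1 : σ → MvPolynomial σ R) i := by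
      simp [Pi.single_apply]
    rw [map_mul, aeval_X, Pi.add_apply, hsingle, Derivation.leibniz, pderiv_X, smul_eq_mul,
      smul_eq_mul]
    ring

variable (p : ℕ) [CharP R p]

theorem dvd_of_mem_support_of_pderiv_eq_zero [IsDomain R] {f : MvPolynomial σ R} {j : σ}
    (h : pderiv j f = 0) {s : σ →₀ ℕ} (hs : s ∈ f.support) : p ∣ s j := by
  rcases Nat.eq_zero_or_pos (s j) with hj | hj
  · exact hj ▸ dvd_zero p
  have hle : Finsupp.single j 1 ≤ s := Finsupp.single_le_iff.2 hj
  have hcoeff := congrArg (coeff (s - Finsupp.single j 1)) h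
  rw [coeff_pderiv, tsub_add_cancel_of_le hle, coeff_zero] at hcoeff
  rw [← CharP.cast_eq_zero_iff R p]
  have hcast : ((s - Finsupp.single j 1 : σ →₀ ℕ) j : R) + 1 = s j := by
    rw [Finsupp.tsub_apply, Finsupp.single_eq_same, ← Nat.cast_add_one, Nat.sub_add_cancel hj]
  rw [← hcast]
  exact (mul_eq_zero.1 hcoeff).resolve_left (mem_support_iff.1 hs)

theorem exists_eq_pow_char_of_pderiv_eq_zero [Fact p.Prime] [IsDomain R] [PerfectRing R p]
    {f : MvPolynomial σ R} (h : ∀ j, pderiv j f = 0) : ∃ g : MvPolynomial σ R, f = g ^ p := by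
  have hroot (s) (hs : s ∈ f.support) : p • s.mapRange (· / p) (Nat.zero_div p) = s := by
    ext j
    simp [Nat.mul_div_cancel' (dvd_of_mem_support_of_pderiv_eq_zero p (h j) hs)]
  refine ⟨∑ s ∈ f.support, monomial (s.mapRange (· / p) (Nat.zero_div p))
    ((frobeniusEquiv R p).symm (f.coeff s)), ?_⟩
  conv_lhs => rw [f.as_sum]
  rw [sum_pow_char]
  refine Finset.sum_congr rfl fun s hs => ?_
  rw [monomial_pow, hroot s hs, frobeniusEquiv_symm_pow_p]

end Polynomials

/-! ### Reduced powers and primitive derivations -/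

/-- The derivation of `A[T]` that applies `D` to each coefficient. -/
def coeffDerivation {R A : Type*} [CommRing R] [CommRing A] [Algebra R A] (D : Derivation R A A) :
    Derivation R (Polynomial A) (Polynomial A) :=
  PolynomialModule.equivPolynomialSelf.compDer D.mapCoeffs

theorem coeff_coeffDerivation {R A : Type*} [CommRing R] [CommRing A] [Algebra R A]
    (D : Derivation R A A) (q : Polynomial A) (k : ℕ) :
    (coeffDerivation D q).coeff k = D (q.coeff k) :=
  rfl

section ReducedPowers

variable (p : ℕ) [Fact p.Prime] {n : ℕ}

theorem polyPower_apply (k : ℕ) (f : Poly p n) :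
    polyPower p k n f = (totalPower p n f).coeff k :=
  rfl

theorem totalPower_X (j : Fin n) :
    totalPower p n (X j) = Polynomial.C (X j) + Polynomial.C (X j ^ p) * Polynomial.X := by
  simp [totalPower]

theorem totalPower_X_pow (j : Fin n) (i : ℕ) :
    totalPower p n (X j ^ p ^ i) =
      Polynomial.C (X j ^ p ^ i) + Polynomial.X ^ p ^ i * Polynomial.C (X j ^ p ^ (i + 1)) := by
  rw [map_pow, totalPower_X, add_pow_char_pow, mul_pow, ← Polynomial.C_pow, ← Polynomial.C_pow,
    ← pow_mul, pow_succ' p i, mul_comm (Polynomial.C _)]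

theorem polyPower_zero (f : Poly p n) : polyPower p 0 n f = f := by
  have hid : (Polynomial.constantCoeff.comp (totalPower p n).toRingHom) = RingHom.id _ := by
    refine ringHom_ext (fun r => ?_) fun j => ?_
    · simp [← algebraMap_eq]
    · simp [totalPower_X]
  simpa [polyPower_apply, Polynomial.constantCoeff_apply] using DFunLike.congr_fun hid f

theorem polyPower_X_pow_mul (j : Fin n) (i : ℕ) (f : Poly p n) :
    polyPower p (p ^ i) n (X j ^ p ^ i * f) =
      X j ^ p ^ i * polyPower p (p ^ i) n f + X j ^ p ^ (i + 1) * f := by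
  simp only [polyPower_apply, map_mul, totalPower_X_pow, add_mul, mul_assoc,
    Polynomial.coeff_add, Polynomial.coeff_C_mul, Polynomial.coeff_X_pow_mul', le_refl, if_true,
    Nat.sub_self]
  rw [← polyPower_apply p 0 f, polyPower_zero]

theorem polyPower_mul_pow_char (k : ℕ) (f : Poly p n) :
    polyPower p (k * p) n (f ^ p) = polyPower p k n f ^ p := by
  rw [polyPower_apply, map_pow, ← Polynomial.map_frobenius_expand, Polynomial.coeff_map,
    Polynomial.coeff_expand_mul (Fact.out : p.Prime).pos]
  rfl

theorem natDegree_totalPower_X_le (j : Fin n) : (totalPower p n (X j)).natDegree ≤ 1 := by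
  rw [totalPower_X, add_comm]
  exact Polynomial.natDegree_linear_le

theorem totalPower_monomial (s : Fin n →₀ ℕ) :
    totalPower p n (monomial s 1) = (s.toMultiset.map fun j => totalPower p n (X j)).prod := by
  rw [monomial_eq, C_1, one_mul, map_finsuppProd, Finsupp.toMultiset_map, Finsupp.prod_toMultiset,
    Finsupp.prod_mapDomain_index (fun _ => pow_zero _) fun _ _ _ => pow_add _ _ _]
  simp only [map_pow]

theorem natDegree_totalPower_monomial_le (s : Fin n →₀ ℕ) :
    (totalPower p n (monomial s 1)).natDegree ≤ s.degree := by
  rw [totalPower_monomial]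
  refine (Polynomial.natDegree_multiset_prod_le _).trans ?_
  rw [Multiset.map_map]
  refine (Multiset.sum_le_card_nsmul _ 1 fun d hd => ?_).trans_eq ?_
  · obtain ⟨j, -, rfl⟩ := Multiset.mem_map.1 hd
    exact natDegree_totalPower_X_le p j
  · rw [Multiset.card_map, Finsupp.card_toMultiset, smul_eq_mul, mul_one]
    rfl

theorem polyPower_degree_monomial (s : Fin n →₀ ℕ) :
    polyPower p s.degree n (monomial s 1) = monomial s 1 ^ p := by
  have hcard : s.degree = (s.toMultiset.map fun j => totalPower p n (X j)).card * 1 := by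
    rw [Multiset.card_map, Finsupp.card_toMultiset, mul_one]
    rfl
  have htop (j : Fin n) : (totalPower p n (X j)).coeff 1 = X j ^ p := by
    simp [totalPower_X, -map_pow, Polynomial.coeff_C]
  rw [polyPower_apply, totalPower_monomial, hcard, Polynomial.coeff_multiset_prod_of_natDegree_le,
    Multiset.map_map]
  · simp only [Function.comp_apply, htop, Multiset.prod_map_pow]
    rw [monomial_eq, C_1, one_mul, Finsupp.toMultiset_map, Finsupp.prod_toMultiset,
      Finsupp.prod_mapDomain_index (fun _ => pow_zero _) fun _ _ _ => pow_add _ _ _]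
  · intro q hq
    obtain ⟨j, -, rfl⟩ := Multiset.mem_map.1 hq
    exact natDegree_totalPower_X_le p j

theorem polyPower_totalDegree (f : Poly p n) :
    polyPower p f.totalDegree n f = homogeneousComponent f.totalDegree f ^ p := by
  have hterm (s) (hs : s ∈ f.support) :
      polyPower p f.totalDegree n (monomial s (f.coeff s)) =
        (if s.degree = f.totalDegree then monomial s (f.coeff s) else 0) ^ p := by
    rw [← mul_one (f.coeff s), ← smul_eq_mul, ← smul_monomial, map_smul]
    split_ifs with hdeg
    · rw [← hdeg, polyPower_degree_monomial, smul_pow, ZMod.pow_card]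
    · rw [polyPower_apply, Polynomial.coeff_eq_zero_of_natDegree_lt, smul_zero,
        zero_pow (Fact.out : p.Prime).ne_zero]
      exact (natDegree_totalPower_monomial_le p s).trans_lt
        (lt_of_le_of_ne (le_totalDegree hs) hdeg)
  conv_lhs => enter [2]; rw [f.as_sum]
  rw [map_sum, Finset.sum_congr rfl hterm, ← sum_pow_char, homogeneousComponent_apply,
    Finset.sum_filter]

/-- The derivation `yⱼ ↦ yⱼ^(pⁱ)`. For `i ≥ 1` it is the action of the Milnor primitive `P^{Δᵢ}`;
for `i = 0` it is the Euler derivation, which is not a reduced power operation. -/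
def primitive (i n : ℕ) : Derivation (ZMod p) (Poly p n) (Poly p n) :=
  mkDerivation (ZMod p) fun j => X j ^ p ^ i

@[simp]
theorem primitive_X (i : ℕ) (j : Fin n) : primitive p i n (X j) = X j ^ p ^ i :=
  mkDerivation_X _ _ _

theorem primitive_eq_sum (i : ℕ) (f : Poly p n) :
    primitive p i n f = ∑ j, X j ^ p ^ i * pderiv j f := by
  induction f using MvPolynomial.induction_on with
  | C a => simp [← algebraMap_eq]
  | add f g hf hg => simp only [map_add, hf, hg, mul_add, Finset.sum_add_distrib]
  | mul_X f k hf =>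
    simp [Derivation.leibniz, hf, pderiv_X, Pi.single_apply, mul_add, Finset.sum_add_distrib,
      Finset.mul_sum, mul_comm, mul_left_comm]

theorem primitive_pow_char (i : ℕ) (f : Poly p n) : primitive p i n (f ^ p) = 0 := by
  simp [Derivation.leibniz_pow, ← Nat.cast_smul_eq_nsmul (Poly p n) p]

theorem primitive_mul_pow_char (i : ℕ) (f g : Poly p n) :
    primitive p i n (f * g ^ p) = primitive p i n f * g ^ p := by
  rw [Derivation.leibniz, primitive_pow_char, smul_zero, zero_add, smul_eq_mul, mul_comm]

theorem polyPower_one (f : Poly p n) : polyPower p 1 n f = primitive p 1 n f := by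
  induction f using MvPolynomial.induction_on with
  | C a =>
    rw [polyPower_apply, ← algebraMap_eq, AlgHom.commutes, Polynomial.algebraMap_apply,
      Derivation.map_algebraMap, Polynomial.coeff_C_of_ne_zero one_ne_zero]
  | add f g hf hg => rw [map_add, hf, hg, map_add]
  | mul_X f j hf =>
    rw [polyPower_apply, map_mul, Polynomial.mul_coeff_one, ← polyPower_apply p 0 f,
      ← polyPower_apply p 1 f, hf, polyPower_zero, totalPower_X, Derivation.leibniz, primitive_X]
    simp [-map_pow, Polynomial.coeff_C, mul_comm (X j)]

theorem coeffDerivation_primitive_totalPower_X (i : ℕ) (j : Fin n) :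
    coeffDerivation (primitive p i n) (totalPower p n (X j)) = Polynomial.C (X j ^ p ^ i) := by
  ext1 k
  rw [coeff_coeffDerivation, totalPower_X, Polynomial.coeff_add, map_add, Polynomial.coeff_C_mul,
    Polynomial.coeff_C, Polynomial.coeff_X, Polynomial.coeff_C]
  split_ifs <;> simp_all

theorem totalPower_primitive (i : ℕ) (f : Poly p n) :
    totalPower p n (primitive p i n f) =
      coeffDerivation (primitive p i n) (totalPower p n f) +
        Polynomial.X ^ p ^ i * coeffDerivation (primitive p (i + 1) n) (totalPower p n f) := by
  induction f using MvPolynomial.induction_on with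
  | C a =>
    rw [← algebraMap_eq, AlgHom.commutes, Derivation.map_algebraMap, Derivation.map_algebraMap,
      Derivation.map_algebraMap, map_zero, mul_zero, add_zero]
  | add f g hf hg =>
    rw [map_add, map_add, hf, hg, map_add, map_add, map_add]
    ring
  | mul_X f j hf =>
    rw [Derivation.leibniz, smul_eq_mul, smul_eq_mul, map_add, map_mul, map_mul, map_mul,
      primitive_X, hf, totalPower_X_pow, Derivation.leibniz, Derivation.leibniz,
      coeffDerivation_primitive_totalPower_X, coeffDerivation_primitive_totalPower_X]
    simp only [smul_eq_mul]
    ring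

theorem primitive_succ (i : ℕ) (f : Poly p n) :
    primitive p (i + 1) n f =
      polyPower p (p ^ i) n (primitive p i n f) - primitive p i n (polyPower p (p ^ i) n f) := by
  have hcoeff := congrArg (fun q => Polynomial.coeff q (p ^ i)) (totalPower_primitive p i f)
  simp only [Polynomial.coeff_add, coeff_coeffDerivation, Polynomial.coeff_X_pow_mul', le_refl,
    if_true, Nat.sub_self, ← polyPower_apply, polyPower_zero] at hcoeff
  rw [hcoeff, add_sub_cancel_left]

variable {p}

/-- Stability of a subspace of `P[y₁, …, yₙ]` under all reduced powers. -/
def PowerStable (W : Submodule (ZMod p) (Poly p n)) : Prop :=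
  ∀ k, ∀ f ∈ W, polyPower p k n f ∈ W

/-- The polynomials whose `p`-th power lies in `W`. Passing from `W` to `pthRoots W` trades
`p`-th powers for lower degrees without losing stability under the reduced powers. -/
def pthRoots (W : Submodule (ZMod p) (Poly p n)) : Submodule (ZMod p) (Poly p n) :=
  W.comap ((frobenius (Poly p n) p).toAddMonoidHom.toZModLinearMap p)

theorem mem_pthRoots {W : Submodule (ZMod p) (Poly p n)} {f : Poly p n} :
    f ∈ pthRoots W ↔ f ^ p ∈ W :=
  Iff.rfl

theorem powerStable_pthRoots {W : Submodule (ZMod p) (Poly p n)} (hW : PowerStable W) :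
    PowerStable (pthRoots W) := fun k f hf =>
  mem_pthRoots.2 (polyPower_mul_pow_char p k f ▸ hW (k * p) _ (mem_pthRoots.1 hf))

theorem PowerStable.primitive_mem {W : Submodule (ZMod p) (Poly p n)} (hW : PowerStable W)
    {f : Poly p n} (hf : f ∈ W) {i : ℕ} (hi : 1 ≤ i) : primitive p i n f ∈ W := by
  induction i, hi using Nat.le_induction generalizing f with
  | base => exact polyPower_one p f ▸ hW 1 f hf
  | succ i _ ih =>
    rw [primitive_succ]
    exact W.sub_mem (hW _ _ (ih hf)) (ih (hW _ _ hf))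

end ReducedPowers

/-! ### Linear forms -/

section LinearForms

variable {σ R K : Type*} [Fintype σ] [CommRing R] [Field K]

/-- The linear form `∑ⱼ vⱼ yⱼ` with coefficient vector `v`. -/
def linForm : (σ → R) →ₗ[R] MvPolynomial σ R :=
  Fintype.linearCombination R X

theorem linForm_apply (v : σ → R) : linForm v = ∑ j, v j • X j :=
  Fintype.linearCombination_apply _ _ _

theorem linForm_injective : Function.Injective (linForm : (σ → R) →ₗ[R] MvPolynomial σ R) :=
  (linearIndependent_X σ R).fintypeLinearCombination_injective

theorem isHomogeneous_linForm (v : σ → R) : (linForm v).IsHomogeneous 1 := by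
  rw [linForm_apply]
  exact IsHomogeneous.sum _ _ _ fun j _ => smul_eq_C_mul (X j) (v j) ▸ isHomogeneous_C_mul_X _ _

theorem linForm_ne_zero {v : σ → R} (hv : v ≠ 0) : linForm v ≠ 0 :=
  (map_ne_zero_iff _ linForm_injective).2 hv

theorem totalDegree_linForm {v : σ → R} (hv : v ≠ 0) : (linForm v).totalDegree = 1 :=
  (isHomogeneous_linForm v).totalDegree (linForm_ne_zero hv)

theorem irreducible_linForm {v : σ → K} (hv : v ≠ 0) : Irreducible (linForm v) := by
  refine irreducible_of_totalDegree_eq_one (totalDegree_linForm hv) fun x hx => ?_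
  obtain ⟨s, hs⟩ := ne_zero_iff.1 (linForm_ne_zero hv)
  exact isUnit_iff_ne_zero.2 (ne_zero_of_dvd_ne_zero hs (hx s))

theorem exists_eq_smul_of_linForm_dvd {v w : σ → K} (hv : v ≠ 0) (h : linForm v ∣ linForm w) :
    ∃ a : K, w = a • v := by
  obtain ⟨a, ha⟩ := exists_eq_C_mul_of_dvd_of_totalDegree_le h
    ((isHomogeneous_linForm w).totalDegree_le.trans (totalDegree_linForm hv).ge)
  exact ⟨a, linForm_injective (by rw [ha, map_smul, smul_eq_C_mul])⟩

theorem exists_GL_col_eq [DecidableEq σ] {v : σ → K} (hv : v ≠ 0) :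
    ∃ (g : GL σ K) (k : σ), g.1.col k = v := by
  obtain ⟨k, hk⟩ := Function.ne_iff.1 hv
  have hdet : (Matrix.updateCol (1 : Matrix σ σ K) k v).det ≠ 0 := by
    rwa [← Matrix.cramer_apply, Matrix.cramer_one]
  refine ⟨Matrix.GeneralLinearGroup.mkOfDetNeZero _ hdet, k, ?_⟩
  ext j
  exact Matrix.updateCol_self

end LinearForms

section LinearSubstitution

variable {p : ℕ} [Fact p.Prime] {n : ℕ}

theorem linForm_pow_char_pow (v : Fin n → ZMod p) (i : ℕ) :
    linForm v ^ p ^ i = ∑ j, v j • X j ^ p ^ i := by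
  simp only [linForm_apply, sum_pow_char_pow, smul_pow, ZMod.pow_card_pow]

theorem primitive_linForm (i : ℕ) (v : Fin n → ZMod p) :
    primitive p i n (linForm v) = linForm v ^ p ^ i := by
  rw [linForm_pow_char_pow, linForm_apply, map_sum]
  simp only [Derivation.map_smul, primitive_X]

theorem polyAct_X (g : Matrix (Fin n) (Fin n) (ZMod p)) (j : Fin n) :
    polyAct p g (X j) = linForm (g.col j) := by
  simp [polyAct, linForm_apply]

theorem primitive_polyAct (i : ℕ) (g : Matrix (Fin n) (Fin n) (ZMod p)) (f : Poly p n) :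
    primitive p i n (polyAct p g f) = polyAct p g (primitive p i n f) := by
  induction f using MvPolynomial.induction_on with
  | C a => rw [← algebraMap_eq, AlgHom.commutes, Derivation.map_algebraMap, map_zero]
  | add f g hf hg => simp only [map_add, hf, hg]
  | mul_X f j hf =>
    simp only [map_mul, map_add, map_pow, Derivation.leibniz, smul_eq_mul, hf, primitive_X,
      polyAct_X, primitive_linForm]

theorem primitive_mem_classicalDickson {f : Poly p n} (hf : f ∈ ClassicalDickson p n) (i : ℕ) :
    primitive p i n f ∈ ClassicalDickson p n :=
  (mem_classicalDickson p).2 fun g => by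
    rw [← primitive_polyAct, (mem_classicalDickson p).1 hf g]

theorem mem_classicalDickson_of_mul_mem {f g : Poly p n} (hf : f ∈ ClassicalDickson p n)
    (hf0 : f ≠ 0) (hfg : f * g ∈ ClassicalDickson p n) : g ∈ ClassicalDickson p n := by
  refine (mem_classicalDickson p).2 fun a => mul_left_cancel₀ hf0 ?_
  simpa only [map_mul, (mem_classicalDickson p).1 hf a] using (mem_classicalDickson p).1 hfg a

theorem mem_classicalDickson_of_pow_char_mem {f : Poly p n} (hf : f ^ p ∈ ClassicalDickson p n) :
    f ∈ ClassicalDickson p n :=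
  (mem_classicalDickson p).2 fun g =>
    frobenius_inj _ p (by simpa only [map_pow, frobenius_def] using (mem_classicalDickson p).1 hf g)

end LinearSubstitution

/-! ### Moore determinants and the Euler class -/

section MooreDeterminants

variable (p : ℕ) [Fact p.Prime] (n : ℕ)

/-- The matrix with rows `(y₁^(p^a), …, yₙ^(p^a))`, where `a` runs through the family `e`. -/
def mooreMatrix {ι : Type*} (e : ι → ℕ) : Matrix ι (Fin n) (Poly p n) :=
  Matrix.of fun i j => X j ^ p ^ e i

/-- The Moore determinant `det (yⱼ^(pⁱ))`, `0 ≤ i < n`. Up to a scalar it is the product of the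
linear forms, one for each point of the projective space over `ℤ/p`. -/
def mooreDet : Poly p n :=
  (mooreMatrix p n fun i : Fin n => (i : ℕ)).det

/-- The top Dickson invariant: up to sign the product of all nonzero linear forms, that is, the
Euler class of the reduced regular representation of `(ℤ/p)ⁿ`. -/
def eulerClass : Poly p n :=
  mooreDet p n ^ (p - 1)

variable {p n}

theorem mooreMatrix_apply {ι : Type*} (e : ι → ℕ) (i : ι) (j : Fin n) :
    mooreMatrix p n e i j = X j ^ p ^ e i :=
  rfl

theorem det_mooreMatrix_ne_zero {e : Fin n → ℕ} (he : Function.Injective e) :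
    (mooreMatrix p n e).det ≠ 0 := by
  let exponent (τ : Equiv.Perm (Fin n)) : Fin n →₀ ℕ :=
    Finsupp.equivFunOnFinite.symm fun j => p ^ e (τ j)
  have hexp : Function.Injective exponent := fun τ τ' h => Equiv.ext fun j =>
    he (Nat.pow_right_injective (Fact.out : p.Prime).two_le (DFunLike.congr_fun h j))
  have hterm (τ : Equiv.Perm (Fin n)) :
      ∏ j, mooreMatrix p n e (τ j) j = monomial (exponent τ) 1 := by
    rw [monomial_eq, C_1, one_mul, Finsupp.prod_fintype _ _ fun _ => pow_zero _]
    rfl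
  refine ne_zero_iff.2 ⟨exponent 1, ?_⟩
  rw [Matrix.det_apply, coeff_sum, Finset.sum_eq_single 1]
  · rw [hterm, Equiv.Perm.sign_one, one_smul, coeff_monomial, if_pos rfl]
    exact one_ne_zero
  · intro τ _ hτ
    rw [hterm, coeff_smul, coeff_monomial, if_neg (hexp.ne hτ), smul_zero]
  · simp

theorem det_mooreMatrix_succ_submatrix {ι : Type*} [Fintype ι] [DecidableEq ι] (e : ι → ℕ)
    (c : ι → Fin n) : ((mooreMatrix p n fun i => e i + 1).submatrix id c).det =
      ((mooreMatrix p n e).submatrix id c).det ^ p := by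
  rw [← frobenius_def, RingHom.map_det]
  congr 1
  ext1 i j
  exact pow_mul (X (c j) : Poly p n) (p ^ e i) p

theorem mooreMatrix_mul_mapMatrix_C {ι : Type*} (e : ι → ℕ)
    (g : Matrix (Fin n) (Fin n) (ZMod p)) :
    mooreMatrix p n e * (C : ZMod p →+* Poly p n).mapMatrix g =
      (mooreMatrix p n e).map (polyAct p g) := by
  ext1 i j
  simp only [Matrix.mul_apply, mooreMatrix_apply, RingHom.mapMatrix_apply, Matrix.map_apply,
    map_pow, polyAct_X, linForm_pow_char_pow, Matrix.col_apply, smul_eq_C_mul, mul_comm]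

theorem mooreDet_ne_zero : mooreDet p n ≠ 0 :=
  det_mooreMatrix_ne_zero Fin.val_injective

theorem polyAct_mooreDet (g : Matrix (Fin n) (Fin n) (ZMod p)) :
    polyAct p g (mooreDet p n) = C g.det * mooreDet p n := by
  rw [mooreDet, AlgHom.map_det, AlgHom.mapMatrix_apply, ← mooreMatrix_mul_mapMatrix_C,
    Matrix.det_mul, ← RingHom.map_det, mul_comm]

theorem isHomogeneous_mooreDet :
    (mooreDet p n).IsHomogeneous (∑ i ∈ Finset.range n, p ^ i) := by
  rw [mooreDet, Matrix.det_apply, ← Fin.sum_univ_eq_sum_range]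
  refine IsHomogeneous.sum _ _ _ fun τ _ => ?_
  rw [← Equiv.sum_comp τ, Units.smul_def]
  exact zsmul_mem (S := Submodule _ _) (K := homogeneousSubmodule _ _ _)
    (IsHomogeneous.prod _ _ _ fun j _ => isHomogeneous_X_pow j _) _

theorem X_dvd_mooreDet (k : Fin n) : X k ∣ mooreDet p n := by
  have hfactor : mooreDet p n =
      (∏ j, X j) * (Matrix.of fun i j : Fin n => X j ^ (p ^ (i : ℕ) - 1)).det := by
    rw [← Matrix.det_mul_row, mooreDet]
    congr
    ext1 i j
    exact (mul_pow_sub_one (pow_pos (Fact.out : p.Prime).pos _).ne' _).symm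
  rw [hfactor]
  exact (Finset.dvd_prod_of_mem _ (Finset.mem_univ k)).mul_right _

theorem linForm_dvd_mooreDet {v : Fin n → ZMod p} (hv : v ≠ 0) : linForm v ∣ mooreDet p n := by
  obtain ⟨g, k, rfl⟩ := exists_GL_col_eq hv
  have hdvd := map_dvd (polyAct p g.1) (X_dvd_mooreDet k)
  rwa [polyAct_X, polyAct_mooreDet,
    ((Matrix.isUnit_iff_isUnit_det _).1 g.isUnit |>.map C).dvd_mul_left] at hdvd

theorem primitive_det_mooreMatrix_cons_zero (i : ℕ) (e : Fin n → ℕ) :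
    primitive p i (n + 1) (mooreMatrix p (n + 1) (Fin.cons 0 fun k => e k + 1)).det =
      (mooreMatrix p (n + 1) (Fin.cons i fun k => e k + 1)).det := by
  have hminor (a : ℕ) (j : Fin (n + 1)) :
      ((mooreMatrix p (n + 1) (Fin.cons a fun k => e k + 1)).submatrix Fin.succ j.succAbove).det =
        ((mooreMatrix p (n + 1) e).submatrix id j.succAbove).det ^ p :=
    det_mooreMatrix_succ_submatrix e j.succAbove
  rw [Matrix.det_succ_row_zero, Matrix.det_succ_row_zero, map_sum]
  refine Finset.sum_congr rfl fun j _ => ?_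
  rw [hminor, hminor, primitive_mul_pow_char, mooreMatrix_apply, mooreMatrix_apply, Fin.cons_zero,
    Fin.cons_zero, pow_zero, pow_one, Derivation.leibniz, primitive_X, Derivation.leibniz_pow,
    map_neg, Derivation.map_one_eq_zero]
  simp

theorem primitive_mooreDet_succ (i : ℕ) : primitive p i (n + 1) (mooreDet p (n + 1)) =
    (mooreMatrix p (n + 1) (Fin.cons i fun k : Fin n => (k : ℕ) + 1)).det := by
  rw [← primitive_det_mooreMatrix_cons_zero, mooreDet]
  congr
  ext k
  refine Fin.cases rfl (fun k => rfl) k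

theorem primitive_mooreDet_eq_zero {i : ℕ} (hi : 1 ≤ i) (hin : i < n) :
    primitive p i n (mooreDet p n) = 0 := by
  obtain ⟨m, rfl⟩ := Nat.exists_eq_succ_of_ne_zero (Nat.ne_zero_of_lt hin)
  obtain ⟨k, rfl⟩ := Nat.exists_eq_add_of_le' hi
  rw [primitive_mooreDet_succ]
  refine Matrix.det_zero_of_row_eq (Fin.succ_ne_zero ⟨k, by lia⟩).symm ?_
  ext1 j
  simp only [mooreMatrix_apply, Fin.cons_zero, Fin.cons_succ]

theorem primitive_self_mooreDet (hn : 1 ≤ n) :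
    primitive p n n (mooreDet p n) = (-1) ^ (n - 1) * mooreDet p n ^ p := by
  obtain ⟨m, rfl⟩ := Nat.exists_eq_add_of_le' hn
  have hrotate : (mooreMatrix p (m + 1) (Fin.cons (m + 1) fun k : Fin m => (k : ℕ) + 1)).submatrix
      (finRotate _) id = (mooreMatrix p (m + 1) fun i : Fin (m + 1) => (i : ℕ) + 1) := by
    ext1 i j
    change X j ^ p ^ (Fin.cons (m + 1) (fun k : Fin m => (k : ℕ) + 1) : Fin (m + 1) → ℕ)
      (finRotate _ i) = X j ^ p ^ ((i : ℕ) + 1)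
    rw [← congrFun (Fin.snoc_eq_cons_rotate _ _) i]
    refine Fin.lastCases ?_ (fun i => ?_) i <;> simp
  have hsign := Matrix.det_permute (finRotate (m + 1))
    (mooreMatrix p (m + 1) (Fin.cons (m + 1) fun k : Fin m => (k : ℕ) + 1))
  have hfrob := det_mooreMatrix_succ_submatrix (p := p) (fun i : Fin (m + 1) => (i : ℕ)) id
  rw [Matrix.submatrix_id_id, Matrix.submatrix_id_id, ← hrotate, hsign, sign_finRotate] at hfrob
  rw [primitive_mooreDet_succ, mooreDet, ← hfrob, ← mul_assoc]
  simp [← mul_pow]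

theorem eulerClass_ne_zero : eulerClass p n ≠ 0 :=
  pow_ne_zero _ mooreDet_ne_zero

theorem eulerClass_mem_classicalDickson : eulerClass p n ∈ ClassicalDickson p n := by
  refine (mem_classicalDickson p).2 fun g => ?_
  have hdet : g.1.det ≠ 0 := ((Matrix.isUnit_iff_isUnit_det _).1 g.isUnit).ne_zero
  rw [eulerClass, map_pow, polyAct_mooreDet, mul_pow, ← C_pow, ZMod.pow_card_sub_one_eq_one hdet,
    C_1, one_mul]

theorem isHomogeneous_eulerClass : (eulerClass p n).IsHomogeneous (p ^ n - 1) := by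
  rw [← geom_sum_mul_of_one_le (Fact.out : p.Prime).one_le]
  exact isHomogeneous_mooreDet.pow _

theorem primitive_eulerClass_eq_zero {i : ℕ} (hi : 1 ≤ i) (hin : i < n) :
    primitive p i n (eulerClass p n) = 0 := by
  rw [eulerClass, Derivation.leibniz_pow, primitive_mooreDet_eq_zero hi hin, smul_zero, smul_zero]

theorem primitive_self_eulerClass (hn : 1 ≤ n) :
    primitive p n n (eulerClass p n) = (-1) ^ n * eulerClass p n ^ 2 := by
  have hp := (Fact.out : p.Prime).two_le
  have hcast : ((p - 1 : ℕ) : Poly p n) = -1 := by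
    rw [Nat.cast_pred (by lia), CharP.cast_eq_zero, zero_sub]
  have hexp : mooreDet p n ^ (p - 1 - 1) * mooreDet p n ^ p = (mooreDet p n ^ (p - 1)) ^ 2 := by
    rw [← pow_add, ← pow_mul]
    congr 1
    lia
  obtain ⟨m, rfl⟩ := Nat.exists_eq_add_of_le' hn
  rw [eulerClass, Derivation.leibniz_pow, primitive_self_mooreDet hn, nsmul_eq_mul, hcast,
    smul_eq_mul, mul_left_comm (mooreDet p _ ^ (p - 1 - 1)), hexp]
  simp [pow_succ]

end MooreDeterminants

/-! ### Divisibility by the Euler class -/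

section Divisibility

variable {p : ℕ} [Fact p.Prime] {n : ℕ}

theorem polyAct_diagonal_X (d : Fin n → ZMod p) (j : Fin n) :
    polyAct p (Matrix.diagonal d) (X j) = C (d j) * X j := by
  simp [polyAct, Matrix.diagonal_apply, smul_eq_C_mul]

theorem coeff_polyAct_diagonal (d : Fin n → ZMod p) (f : Poly p n) (s : Fin n →₀ ℕ) :
    (polyAct p (Matrix.diagonal d) f).coeff s = (∏ j, d j ^ s j) * f.coeff s := by
  induction f using MvPolynomial.induction_on' with
  | add f g hf hg => rw [map_add, coeff_add, hf, hg, coeff_add, mul_add]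
  | monomial t a =>
    have hmonomial : polyAct p (Matrix.diagonal d) (monomial t a) =
        C (∏ j, d j ^ t j) * monomial t a := by
      simp only [monomial_eq, Finsupp.prod_fintype _ _ fun _ => pow_zero _, map_mul, map_prod,
        map_pow, polyAct_diagonal_X, mul_pow, Finset.prod_mul_distrib]
      rw [← algebraMap_eq, AlgHom.commutes, mul_left_comm]
    rw [hmonomial, coeff_C_mul, coeff_monomial]
    split_ifs with hts
    · rw [hts]
    · rw [mul_zero, mul_zero]

theorem polyAct_transvection (k j : Fin n) (f : Poly p n) :
    polyAct p (Matrix.transvection k j 1) f = aeval (X + Pi.single j (X k)) f := by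
  congr 1
  refine algHom_ext fun l => ?_
  have hcol : (Matrix.transvection k j (1 : ZMod p)).col l =
      Pi.single l 1 + (Pi.single j (Pi.single k 1) : Fin n → Fin n → ZMod p) l := by
    ext i
    rcases eq_or_ne j l with rfl | hjl
    · simp [Matrix.transvection, Matrix.one_apply, Matrix.single_apply, Pi.single_apply, eq_comm]
    · simp [Matrix.transvection, Matrix.one_apply, hjl, Pi.single_apply, hjl.symm]
  have hsingle (i : Fin n) : linForm (Pi.single i 1) = (X i : Poly p n) := by
    simp [linForm_apply, Pi.single_apply]
  rw [polyAct_X, hcol, map_add, hsingle, aeval_X, Pi.add_apply]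
  rcases eq_or_ne l j with rfl | hlj
  · simp [hsingle]
  · simp [hlj]

theorem polyAct_eq_of_det_ne_zero {f : Poly p n} (hf : f ∈ ClassicalDickson p n)
    {g : Matrix (Fin n) (Fin n) (ZMod p)} (hg : g.det ≠ 0) : polyAct p g f = f :=
  (mem_classicalDickson p).1 hf (Matrix.GeneralLinearGroup.mkOfDetNeZero g hg)

theorem sub_one_dvd_of_mem_support {f : Poly p n} (hf : f ∈ ClassicalDickson p n)
    {s : Fin n →₀ ℕ} (hs : s ∈ f.support) (k : Fin n) : p - 1 ∣ s k := by
  have hpow (a : (ZMod p)ˣ) : (a : ZMod p) ^ s k = 1 := by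
    have hdet : (Matrix.diagonal (Pi.mulSingle k (a : ZMod p))).det ≠ 0 := by
      rw [Matrix.det_diagonal, Finset.prod_eq_single k (fun j _ hj => Pi.mulSingle_eq_of_ne hj _)
        (by simp), Pi.mulSingle_eq_same]
      exact a.ne_zero
    have hcoeff := congrArg (coeff s) (polyAct_eq_of_det_ne_zero hf hdet)
    rw [coeff_polyAct_diagonal, mul_eq_right₀ (mem_support_iff.1 hs)] at hcoeff
    rwa [Finset.prod_eq_single k (fun j _ hj => by rw [Pi.mulSingle_eq_of_ne hj, one_pow])
      (by simp), Pi.mulSingle_eq_same] at hcoeff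
  have hdvd := (FiniteField.forall_pow_eq_one_iff (ZMod p) (s k)).1 fun a =>
    Units.ext (by simpa using hpow a)
  rwa [ZMod.card] at hdvd

theorem X_pow_dvd_of_X_dvd {f : Poly p n} (hf : f ∈ ClassicalDickson p n) {k : Fin n}
    (hk : X k ∣ f) : X k ^ (p - 1) ∣ f := by
  rw [f.as_sum]
  refine Finset.dvd_sum fun s hs => ?_
  have hpos : 0 < s k := by
    obtain ⟨q, rfl⟩ := hk
    rw [mem_support_iff, coeff_X_mul', ite_ne_right_iff] at hs
    exact Nat.pos_of_ne_zero (Finsupp.mem_support_iff.1 hs.1)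
  rw [X_pow_eq_monomial, monomial_dvd_monomial, Finsupp.single_le_iff]
  exact ⟨Or.inr (Nat.le_of_dvd hpos (sub_one_dvd_of_mem_support hf hs k)), one_dvd _⟩

theorem linForm_pow_dvd_of_X_dvd {f : Poly p n} (hf : f ∈ ClassicalDickson p n)
    (hX : ∀ k, X k ∣ f) {v : Fin n → ZMod p} (hv : v ≠ 0) : linForm v ^ (p - 1) ∣ f := by
  obtain ⟨g, k, rfl⟩ := exists_GL_col_eq hv
  have hdvd := map_dvd (polyAct p g.1) (X_pow_dvd_of_X_dvd hf (hX k))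
  rwa [map_pow, polyAct_X, (mem_classicalDickson p).1 hf] at hdvd

theorem isRelPrime_linForm_rep {K σ : Type*} [Field K] [Fintype σ]
    {P Q : Projectivization K (σ → K)} (hPQ : P ≠ Q) :
    IsRelPrime (linForm P.rep) (linForm Q.rep) := by
  refine ((irreducible_linForm P.rep_nonzero).isRelPrime_iff_not_dvd).2 fun hdvd => hPQ ?_
  obtain ⟨a, ha⟩ := exists_eq_smul_of_linForm_dvd P.rep_nonzero hdvd
  rw [← P.mk_rep, ← Q.mk_rep, eq_comm, Projectivization.mk_eq_mk_iff']
  exact ⟨a, ha.symm⟩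

theorem exists_mooreDet_eq_C_mul_prod [Fintype (Projectivization (ZMod p) (Fin n → ZMod p))] :
    ∃ c : ZMod p, mooreDet p n =
      C c * ∏ P : Projectivization (ZMod p) (Fin n → ZMod p), linForm P.rep := by
  have hdvd : ∏ P : Projectivization (ZMod p) (Fin n → ZMod p), linForm P.rep ∣ mooreDet p n :=
    Fintype.prod_dvd_of_isRelPrime (fun P Q hPQ => isRelPrime_linForm_rep hPQ)
      fun P => linForm_dvd_mooreDet P.rep_nonzero
  have hdeg : (∏ P : Projectivization (ZMod p) (Fin n → ZMod p), linForm P.rep).totalDegree =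
      ∑ i ∈ Finset.range n, p ^ i := by
    rw [(IsHomogeneous.prod _ _ _ fun P _ => isHomogeneous_linForm P.rep).totalDegree
      (Finset.prod_ne_zero_iff.2 fun P _ => linForm_ne_zero P.rep_nonzero), Finset.sum_const,
      smul_eq_mul, mul_one, Finset.card_univ, ← Nat.card_eq_fintype_card,
      Projectivization.card_of_finrank (n := n) (ZMod p) _ (by simp), Nat.card_zmod]
  exact exists_eq_C_mul_of_dvd_of_totalDegree_le hdvd
    (hdeg ▸ isHomogeneous_mooreDet.totalDegree_le)

theorem eulerClass_dvd_of_X_dvd {f : Poly p n} (hf : f ∈ ClassicalDickson p n)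
    (hX : ∀ k, X k ∣ f) : eulerClass p n ∣ f := by
  have : Fintype (Projectivization (ZMod p) (Fin n → ZMod p)) := Fintype.ofFinite _
  obtain ⟨c, hc⟩ := exists_mooreDet_eq_C_mul_prod (p := p) (n := n)
  have hc0 : c ≠ 0 := by
    rintro rfl
    exact mooreDet_ne_zero (by rw [hc, C_0, zero_mul])
  rw [eulerClass, hc, mul_pow, ((hc0.isUnit.map C).pow _).mul_left_dvd, ← Finset.prod_pow]
  exact Fintype.prod_dvd_of_isRelPrime (fun P Q hPQ => (isRelPrime_linForm_rep hPQ).pow)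
    fun P => linForm_pow_dvd_of_X_dvd hf hX P.rep_nonzero

theorem X_dvd_pderiv {f : Poly p n} (hf : f ∈ ClassicalDickson p n) {j k : Fin n}
    (hkj : k ≠ j) : X k ∣ pderiv j f := by
  have hdet : (Matrix.transvection k j (1 : ZMod p)).det ≠ 0 := by
    rw [Matrix.det_transvection_of_ne k j hkj]
    exact one_ne_zero
  have htaylor := sq_dvd_aeval_add_single_sub j (X k) f
  rw [← polyAct_transvection, polyAct_eq_of_det_ne_zero hf hdet, sub_self, zero_sub, dvd_neg,
    sq, mul_dvd_mul_iff_left (X_ne_zero k)] at htaylor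
  exact htaylor

theorem eulerClass_dvd_primitive {f : Poly p n} (hf : f ∈ ClassicalDickson p n) (i : ℕ) :
    eulerClass p n ∣ primitive p i n f := by
  refine eulerClass_dvd_of_X_dvd (primitive_mem_classicalDickson hf i) fun k => ?_
  rw [primitive_eq_sum]
  refine Finset.dvd_sum fun j _ => ?_
  rcases eq_or_ne k j with rfl | hkj
  · exact (dvd_pow_self _ (pow_pos (Fact.out : p.Prime).pos i).ne').mul_right _
  · exact (X_dvd_pderiv hf hkj).mul_left _

end Divisibility

/-! ### Descent in stable subspaces -/

theorem one_ceilDiv {b : ℕ} (hb : 0 < b) : 1 ⌈/⌉ b = 1 := by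
  rw [Nat.ceilDiv_eq_add_pred_div, Nat.add_sub_cancel_left, Nat.div_self hb]

theorem ceilDiv_pos {a b : ℕ} (hb : 0 < b) (ha : 0 < a) : 0 < a ⌈/⌉ b := by
  by_contra! h
  simpa [ha.ne'] using (ceilDiv_le_iff_le_mul hb).1 h

theorem ceilDiv_lt_self {a b : ℕ} (hb : 1 < b) (ha : 1 < a) : a ⌈/⌉ b < a := by
  have h : a ⌈/⌉ b ≤ a - 1 :=
    (ceilDiv_le_iff_le_mul (by lia)).2 (by nlinarith [Nat.sub_add_cancel ha.le])
  lia

section Descent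

variable {p : ℕ} [Fact p.Prime] {n : ℕ}

theorem isHomogeneous_primitive {m : ℕ} {f : Poly p n} (hf : f.IsHomogeneous m) (i : ℕ) :
    (primitive p i n f).IsHomogeneous (p ^ i + (m - 1)) := by
  rw [primitive_eq_sum]
  exact IsHomogeneous.sum _ _ _ fun j _ => (isHomogeneous_X_pow j _).mul hf.pderiv

theorem primitive_zero_of_isHomogeneous {m : ℕ} {f : Poly p n} (hf : f.IsHomogeneous m) :
    primitive p 0 n f = (m : Poly p n) * f := by
  simp only [primitive_eq_sum, pow_zero, pow_one, hf.sum_X_mul_pderiv, nsmul_eq_mul]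

theorem pderiv_eq_zero_of_primitive_eq_zero {f : Poly p n}
    (hf : ∀ i < n, primitive p i n f = 0) (j : Fin n) : pderiv j f = 0 := by
  have hmul : (mooreMatrix p n fun i : Fin n => (i : ℕ)).mulVec (fun j => pderiv j f) = 0 := by
    ext1 i
    simpa only [Matrix.mulVec, dotProduct, mooreMatrix_apply, primitive_eq_sum,
      Pi.zero_apply] using hf i i.2
  have hdet := det_mooreMatrix_ne_zero (p := p) (n := n) Fin.val_injective
  exact congrFun (Matrix.eq_zero_of_mulVec_eq_zero hdet hmul) j

theorem primitive_eulerClass_pow_mul {i : ℕ} (hi : 1 ≤ i) (hin : i < n) (a : ℕ) (g : Poly p n) :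
    primitive p i n (eulerClass p n ^ a * g) = eulerClass p n ^ a * primitive p i n g := by
  rw [Derivation.leibniz, Derivation.leibniz_pow, primitive_eulerClass_eq_zero hi hin,
    smul_zero, smul_zero, smul_zero, add_zero, smul_eq_mul]

theorem primitive_self_eulerClass_pow_mul_pow_char (hn : 1 ≤ n) (b : ℕ) (h : Poly p n) :
    primitive p n n (eulerClass p n ^ b * h ^ p) =
      ((b : ZMod p) * (-1) ^ n) • (eulerClass p n ^ (b + 1) * h ^ p) := by
  rw [primitive_mul_pow_char, Derivation.leibniz_pow, primitive_self_eulerClass hn]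
  rcases b with - | b
  · simp
  · simp only [smul_eq_mul, smul_eq_C_mul, nsmul_eq_mul, map_mul, map_pow, map_neg, map_one,
      map_natCast, Nat.add_sub_cancel]
    ring

theorem eulerClass_dvd_of_dvd_pow {f : Poly p n} (hf : f ∈ ClassicalDickson p n) {m : ℕ}
    (h : eulerClass p n ∣ f ^ m) : eulerClass p n ∣ f := by
  have hp := (Fact.out : p.Prime).one_lt
  exact eulerClass_dvd_of_X_dvd hf fun k => (X_prime (i := k)).dvd_of_dvd_pow
    (((X_dvd_mooreDet k).trans (dvd_pow_self _ (Nat.sub_pos_of_lt hp).ne')).trans h)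

-- The exponent is chosen to make the degree divisible by `p`, so that the Euler derivation
-- `primitive p 0 n` vanishes as well.
theorem exists_eulerClass_pow_mul_eq_pow_char (hn : 1 ≤ n) {m : ℕ} {g : Poly p n}
    (hm : g.IsHomogeneous m) (hg : ∀ i, 1 ≤ i → i < n → primitive p i n g = 0) :
    ∃ e < p, ∃ r : Poly p n, eulerClass p n ^ e * g = r ^ p := by
  have hp := (Fact.out : p.Prime)
  refine ⟨m % p, Nat.mod_lt _ hp.pos,
    exists_eq_pow_char_of_pderiv_eq_zero p (pderiv_eq_zero_of_primitive_eq_zero fun i hi => ?_)⟩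
  rcases Nat.eq_zero_or_pos i with rfl | hi0
  · have hdvd : p ∣ (p ^ n - 1) * (m % p) + m := by
      rw [← CharP.cast_eq_zero_iff (ZMod p) p]
      simp [Nat.cast_pred (pow_pos hp.pos n), Nat.one_le_iff_ne_zero.1 hn]
    rw [primitive_zero_of_isHomogeneous ((isHomogeneous_eulerClass.pow _).mul hm),
      (CharP.cast_eq_zero_iff (Poly p n) p _).2 hdvd, zero_mul]
  · rw [primitive_eulerClass_pow_mul hi0 hi, hg i hi0 hi, mul_zero]

theorem exists_eq_eulerClass_pow_mul_pow_char (hn : 1 ≤ n) {m : ℕ} {g : Poly p n}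
    (hg : g ∈ ClassicalDickson p n) (hm : g.IsHomogeneous m)
    (hprim : ∀ i, 1 ≤ i → i < n → primitive p i n g = 0) :
    ∃ (b : ℕ) (h : Poly p n), h ∈ ClassicalDickson p n ∧ g = eulerClass p n ^ b * h ^ p := by
  obtain ⟨e, hep, r, hr⟩ := exists_eulerClass_pow_mul_eq_pow_char hn hm hprim
  have hrmem : r ∈ ClassicalDickson p n := mem_classicalDickson_of_pow_char_mem
    (hr ▸ mul_mem (pow_mem eulerClass_mem_classicalDickson e) hg)
  rcases Nat.eq_zero_or_pos e with rfl | he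
  · exact ⟨0, r, hrmem, by rw [← hr, pow_zero, one_mul, one_mul]⟩
  · obtain ⟨q, rfl⟩ := eulerClass_dvd_of_dvd_pow hrmem
      (hr ▸ (dvd_pow_self (eulerClass p n) he.ne').mul_right g)
    refine ⟨p - e, q, mem_classicalDickson_of_mul_mem eulerClass_mem_classicalDickson
      eulerClass_ne_zero hrmem, mul_left_cancel₀ (pow_ne_zero e eulerClass_ne_zero) ?_⟩
    rw [hr, ← mul_assoc, ← pow_add, Nat.add_sub_cancel' hep.le, mul_pow]

variable {W : Submodule (ZMod p) (Poly p n)}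

theorem PowerStable.eulerClass_pow_mul_mem_pthRoots (hW : PowerStable W) (hn : 1 ≤ n) {a : ℕ}
    {h : Poly p n} (hmem : eulerClass p n ^ a * h ^ p ∈ W) :
    eulerClass p n ^ (a ⌈/⌉ p) * h ∈ pthRoots W := by
  have hp := (Fact.out : p.Prime)
  have hclimb (b : ℕ) (hab : a ≤ b) (hb : b ≤ p * (a ⌈/⌉ p)) : eulerClass p n ^ b * h ^ p ∈ W := by
    induction b, hab using Nat.le_induction with
    | base => exact hmem
    | succ b hab ih =>
      have hpb : ¬ p ∣ b := by
        rintro ⟨q, rfl⟩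
        have hle : a ⌈/⌉ p ≤ q := (ceilDiv_le_iff_le_mul hp.pos).2 hab
        exact absurd (Nat.lt_of_succ_le hb) (Nat.mul_le_mul_left p hle).not_gt
      have hprim := hW.primitive_mem (ih (by lia)) hn
      rwa [primitive_self_eulerClass_pow_mul_pow_char hn, W.smul_mem_iff (mul_ne_zero
        (mt (ZMod.natCast_eq_zero_iff b p).1 hpb) (pow_ne_zero n (neg_ne_zero.2 one_ne_zero)))]
        at hprim
  have htop := hclimb (p * (a ⌈/⌉ p)) (le_smul_ceilDiv hp.pos) le_rfl
  rwa [mul_comm p, pow_mul, ← mul_pow, ← mem_pthRoots] at htop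

theorem eventually_eulerClass_pow_mem_of_pthRoots
    (h : ∀ᶠ k in Filter.atTop, eulerClass p n ^ p ^ k ∈ pthRoots W) :
    ∀ᶠ k in Filter.atTop, eulerClass p n ^ p ^ k ∈ W := by
  rw [← Filter.map_add_atTop_eq_nat 1, Filter.eventually_map]
  exact h.mono fun k hk => by rwa [mem_pthRoots, ← pow_mul, ← pow_succ] at hk

theorem PowerStable.eulerClass_pow_char_pow_mem (hW : PowerStable W) (hn : 1 ≤ n)
    (h : eulerClass p n ∈ W) (k : ℕ) : eulerClass p n ^ p ^ k ∈ W := by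
  induction k generalizing W with
  | zero => simpa only [pow_zero, pow_one] using h
  | succ k ih =>
    have hroot := hW.eulerClass_pow_mul_mem_pthRoots hn (a := 1) (h := 1) (by simpa using h)
    rw [one_ceilDiv (Fact.out : p.Prime).pos, pow_one, mul_one] at hroot
    rw [pow_succ, pow_mul]
    exact mem_pthRoots.1 (ih (powerStable_pthRoots hW) hroot)

theorem PowerStable.eventually_eulerClass_pow_mem_of_pow_mem (hW : PowerStable W) (hn : 1 ≤ n)
    {a : ℕ} (ha : 0 < a) (h : eulerClass p n ^ a ∈ W) :
    ∀ᶠ k in Filter.atTop, eulerClass p n ^ p ^ k ∈ W := by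
  have hp := (Fact.out : p.Prime)
  induction a using Nat.strong_induction_on generalizing W with
  | _ a ih =>
    rcases Nat.eq_or_lt_of_le (Nat.succ_le_of_lt ha) with rfl | ha1
    · rw [pow_one] at h
      exact Filter.Eventually.of_forall (hW.eulerClass_pow_char_pow_mem hn h)
    · have hroot := hW.eulerClass_pow_mul_mem_pthRoots hn (a := a) (h := 1) (by simpa using h)
      rw [mul_one] at hroot
      exact eventually_eulerClass_pow_mem_of_pthRoots (ih _ (ceilDiv_lt_self hp.one_lt ha1)
        (powerStable_pthRoots hW) (ceilDiv_pos hp.pos ha) hroot)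

theorem totalDegree_eulerClass_pow_mul {g : Poly p n} (hg : g ≠ 0) (b : ℕ) :
    (eulerClass p n ^ b * g).totalDegree = (p ^ n - 1) * b + g.totalDegree := by
  have hE := pow_ne_zero b (eulerClass_ne_zero (p := p) (n := n))
  rw [totalDegree_mul_of_isDomain hE hg, (isHomogeneous_eulerClass.pow b).totalDegree hE]

theorem exists_primitive_eq_eulerClass_mul {g : Poly p n} (hg : g ∈ ClassicalDickson p n)
    {m : ℕ} (hm : g.IsHomogeneous m) {i : ℕ} (hin : i < n) (hne : primitive p i n g ≠ 0) :
    ∃ q : Poly p n, primitive p i n g = eulerClass p n * q ∧ q ∈ ClassicalDickson p n ∧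
      q.IsHomogeneous q.totalDegree ∧ q.totalDegree < m := by
  obtain ⟨q, hq⟩ := eulerClass_dvd_primitive hg i
  have hq0 : q ≠ 0 := right_ne_zero_of_mul (hq ▸ hne)
  have hhom := isHomogeneous_primitive hm i
  have hm0 : m ≠ 0 := by
    rintro rfl
    rw [totalDegree_eq_zero_iff_eq_C.1 (Nat.le_zero.1 hm.totalDegree_le), ← algebraMap_eq,
      Derivation.map_algebraMap] at hne
    exact hne rfl
  have hdeg : p ^ n - 1 + q.totalDegree = p ^ i + (m - 1) := by
    rw [← hhom.totalDegree hne, hq, ← pow_one (eulerClass p n),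
      totalDegree_eulerClass_pow_mul hq0, mul_one]
  have hlt : p ^ i < p ^ n := Nat.pow_lt_pow_right (Fact.out : p.Prime).one_lt hin
  exact ⟨q, hq, mem_classicalDickson_of_mul_mem eulerClass_mem_classicalDickson
    eulerClass_ne_zero (hq ▸ primitive_mem_classicalDickson hg i),
    isHomogeneous_of_dvd hhom hne (hq ▸ dvd_mul_left _ _), by lia⟩

-- Induction on the degree of `g`: a primitive that does not kill `g` splits off a factor
-- `eulerClass p n`, and if all of them do, then `g` is a `p`-th power up to such factors.
theorem PowerStable.eventually_eulerClass_pow_mem_of_isHomogeneous (hW : PowerStable W)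
    (hn : 1 ≤ n) {a : ℕ} {g : Poly p n} (hg : g ∈ ClassicalDickson p n) (hg0 : g ≠ 0)
    (hhom : g.IsHomogeneous g.totalDegree) (hpos : 0 < a ∨ 0 < g.totalDegree)
    (hmem : eulerClass p n ^ a * g ∈ W) :
    ∀ᶠ k in Filter.atTop, eulerClass p n ^ p ^ k ∈ W := by
  have hp := (Fact.out : p.Prime)
  induction hd : g.totalDegree using Nat.strong_induction_on generalizing a g W with
  | _ d ih =>
    subst hd
    rcases Nat.eq_zero_or_pos g.totalDegree with hdeg | hdeg
    · have hC : g = C (g.coeff 0) := totalDegree_eq_zero_iff_eq_C.1 hdeg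
      have hcoeff : g.coeff 0 ≠ 0 := fun h0 => hg0 (by rw [hC, h0, map_zero])
      rw [hC, mul_comm, ← smul_eq_C_mul, W.smul_mem_iff hcoeff] at hmem
      exact hW.eventually_eulerClass_pow_mem_of_pow_mem hn (hpos.resolve_right hdeg.not_gt) hmem
    by_cases hprim : ∀ i, 1 ≤ i → i < n → primitive p i n g = 0
    · obtain ⟨b, h, hh, rfl⟩ := exists_eq_eulerClass_pow_mul_pow_char hn hg hhom hprim
      have hh0 : h ≠ 0 := by
        rintro rfl
        simp [hp.ne_zero] at hg0
      have hq := Nat.one_lt_pow (Nat.one_le_iff_ne_zero.1 hn) hp.one_lt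
      have hhhom := isHomogeneous_of_dvd hhom hg0 ((dvd_pow_self h hp.ne_zero).mul_left _)
      rw [totalDegree_eulerClass_pow_mul (pow_ne_zero p hh0),
        (hhhom.pow p).totalDegree (pow_ne_zero p hh0)] at ih hdeg
      rw [← mul_assoc, ← pow_add] at hmem
      refine eventually_eulerClass_pow_mem_of_pthRoots (ih _ ?_ (powerStable_pthRoots hW) hh hh0
        hhhom ?_ (hW.eulerClass_pow_mul_mem_pthRoots hn hmem) rfl)
      · nlinarith [hp.two_le]
      · rcases Nat.eq_zero_or_pos b with rfl | hb
        · exact Or.inr (Nat.pos_of_mul_pos_right (by simpa using hdeg))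
        · exact Or.inl (ceilDiv_pos hp.pos (by lia))
    · push Not at hprim
      obtain ⟨i, hi, hin, hne⟩ := hprim
      obtain ⟨q, hq, hqmem, hqhom, hlt⟩ := exists_primitive_eq_eulerClass_mul hg hhom hin hne
      have hstep := hW.primitive_mem hmem hi
      rw [primitive_eulerClass_pow_mul hi hin, hq, ← mul_assoc, ← pow_succ] at hstep
      exact ih _ hlt hW hqmem (right_ne_zero_of_mul (hq ▸ hne)) hqhom (Or.inl a.succ_pos) hstep rfl

theorem totalDegree_pos_of_polyAug_eq_zero {f : Poly p n} (hf0 : f ≠ 0)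
    (haug : polyAug p n f = 0) : 0 < f.totalDegree := by
  refine Nat.pos_of_ne_zero fun h => hf0 ?_
  rw [totalDegree_eq_zero_iff_eq_C.1 h] at haug ⊢
  simpa [polyAug] using haug

theorem homogeneousComponent_totalDegree_mem_classicalDickson {f : Poly p n}
    (hf : f ∈ ClassicalDickson p n) :
    homogeneousComponent f.totalDegree f ∈ ClassicalDickson p n := by
  refine mem_classicalDickson_of_pow_char_mem ((mem_classicalDickson p).2 fun g => ?_)
  rw [← polyPower_totalDegree, ← polyPower_polyAct, (mem_classicalDickson p).1 hf g]

theorem PowerStable.eventually_eulerClass_pow_mem (hW : PowerStable W) (hn : 1 ≤ n) {f : Poly p n}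
    (hfW : f ∈ W) (hf : f ∈ ClassicalDickson p n) (hf0 : f ≠ 0) (haug : polyAug p n f = 0) :
    ∀ᶠ k in Filter.atTop, eulerClass p n ^ p ^ k ∈ W := by
  have hg0 := homogeneousComponent_totalDegree_ne_zero hf0
  have hhom := homogeneousComponent_isHomogeneous f.totalDegree f
  have hdeg := hhom.totalDegree hg0
  have hroot : homogeneousComponent f.totalDegree f ∈ pthRoots W := by
    rw [mem_pthRoots, ← polyPower_totalDegree]
    exact hW f.totalDegree f hfW
  exact eventually_eulerClass_pow_mem_of_pthRoots <|
    (powerStable_pthRoots hW).eventually_eulerClass_pow_mem_of_isHomogeneous hn (a := 0)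
      (homogeneousComponent_totalDegree_mem_classicalDickson hf) hg0 (by rwa [hdeg])
      (Or.inr (by rw [hdeg]; exact totalDegree_pos_of_polyAug_eq_zero hf0 haug))
      (by rwa [pow_zero, one_mul])

end Descent

/-! ### Contractions of the exterior algebra -/

section Contraction

variable {R V M : Type*} [CommRing R] [AddCommGroup V] [Module R V] [AddCommGroup M] [Module R M]

/-- The signed derivation of the exterior algebra that extends the linear form `d`. -/
def contraction (d : Module.Dual R V) : Module.End R (ExteriorAlgebra R V) :=
  CliffordAlgebra.contractLeft (Q := (0 : QuadraticForm R V)) d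

theorem contraction_algebraMap (d : Module.Dual R V) (r : R) :
    contraction d (algebraMap R (ExteriorAlgebra R V) r) = 0 :=
  CliffordAlgebra.contractLeft_algebraMap (0 : QuadraticForm R V) d r

theorem contraction_ι_mul (d : Module.Dual R V) (v : V) (e : ExteriorAlgebra R V) :
    contraction d (ExteriorAlgebra.ι R v * e) =
      d v • e - ExteriorAlgebra.ι R v * contraction d e :=
  CliffordAlgebra.contractLeft_ι_mul (Q := (0 : QuadraticForm R V)) d v e

theorem contraction_contraction_self (d : Module.Dual R V) (e : ExteriorAlgebra R V) :
    contraction d (contraction d e) = 0 :=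
  CliffordAlgebra.contractLeft_contractLeft (Q := (0 : QuadraticForm R V)) d e

theorem contraction_comm (d d' : Module.Dual R V) (e : ExteriorAlgebra R V) :
    contraction d (contraction d' e) = -contraction d' (contraction d e) :=
  CliffordAlgebra.contractLeft_comm (Q := (0 : QuadraticForm R V)) d d' e

open ExteriorAlgebra in
theorem eq_map_add_ι_mul_map_contraction (d : Module.Dual R V) (v : V) (e : ExteriorAlgebra R V) :
    e = map (LinearMap.id - d.smulRight v) e +
      ι R v * map (LinearMap.id - d.smulRight v) (contraction d e) := by
  set φ := map (LinearMap.id - d.smulRight v)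
  have step (m : V) (x : ExteriorAlgebra R V) (hx : x = φ x + ι R v * φ (contraction d x)) :
      ι R m * x = φ (ι R m * x) + ι R v * φ (contraction d (ι R m * x)) := by
    have hm : ι R m = φ (ι R m) + d m • ι R v := by simp [φ]
    have hswap : ι R v * φ (ι R m) = -(φ (ι R m) * ι R v) := by
      rw [map_apply_ι]
      exact eq_neg_of_add_eq_zero_left (ι_add_mul_swap _ _)
    calc ι R m * x
        = φ (ι R m) * (φ x + ι R v * φ (contraction d x)) +
            d m • (ι R v * (φ x + ι R v * φ (contraction d x))) := by
          rw [← hx, ← smul_mul_assoc, ← add_mul, ← hm]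
      _ = φ (ι R m) * φ x + d m • (ι R v * φ x) +
            φ (ι R m) * ι R v * φ (contraction d x) := by
          simp only [mul_add, ← mul_assoc, ι_sq_zero, zero_mul, add_zero]
          abel
      _ = _ := by
          rw [contraction_ι_mul, map_mul, map_sub, map_smul, map_mul, mul_sub, ← mul_assoc _ _
            (φ (contraction d x)), hswap, mul_smul_comm, neg_mul, sub_neg_eq_add, add_assoc]
  induction e using CliffordAlgebra.left_induction with
  | algebraMap r =>
    exact (by rw [AlgHom.commutes, contraction_algebraMap, map_zero, mul_zero, add_zero] :
      algebraMap R (ExteriorAlgebra R V) r = φ (algebraMap R _ r) +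
        ι R v * φ (contraction d (algebraMap R _ r)))
  | add x y hx hy =>
    rw [map_add, map_add, map_add, mul_add, add_add_add_comm, ← hx, ← hy]
  | ι_mul x m hx => exact step m x hx

theorem rTensor_map_sub_smulRight {d : Module.Dual R V} {z : ExteriorAlgebra R V ⊗[R] M}
    (hz : (contraction d).rTensor M z = 0) (v : V) :
    (ExteriorAlgebra.map (LinearMap.id - d.smulRight v)).toLinearMap.rTensor M z = z := by
  set φ := (ExteriorAlgebra.map (LinearMap.id - d.smulRight v)).toLinearMap
  have hid : LinearMap.id =
      φ + (LinearMap.mulLeft R (ExteriorAlgebra.ι R v) ∘ₗ φ) ∘ₗ contraction d :=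
    LinearMap.ext (eq_map_add_ι_mul_map_contraction d v)
  have h := congrArg (fun ψ => ψ.rTensor M z) hid
  simpa only [LinearMap.rTensor_add, LinearMap.rTensor_comp, LinearMap.add_apply,
    LinearMap.comp_apply, hz, map_zero, add_zero, LinearMap.rTensor_id, LinearMap.id_apply,
    eq_comm] using h

theorem map_zero_eq_ofId_comp_algebraMapInv :
    ExteriorAlgebra.map (0 : V →ₗ[R] V) =
      (Algebra.ofId R (ExteriorAlgebra R V)).comp ExteriorAlgebra.algebraMapInv := by
  ext v
  simp [ExteriorAlgebra.algebraMapInv]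

theorem exists_map_fixes_of_contraction_eq_zero {ι : Type*}
    {z : ExteriorAlgebra R (ι → R) ⊗[R] M}
    (hz : ∀ j, (contraction (LinearMap.proj j)).rTensor M z = 0) (s : Finset ι) :
    ∃ φ : (ι → R) →ₗ[R] (ι → R), (∀ v, ∀ i ∈ s, φ v i = 0) ∧
      (ExteriorAlgebra.map φ).toLinearMap.rTensor M z = z := by
  classical
  induction s using Finset.induction_on with
  | empty => exact ⟨LinearMap.id, by simp, by simp⟩
  | insert j s _ ih =>
    obtain ⟨φ, hφ, hfix⟩ := ih
    refine ⟨(LinearMap.id - (LinearMap.proj j).smulRight (Pi.single j 1)) ∘ₗ φ,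
      fun v i hi => ?_, ?_⟩
    · rcases eq_or_ne i j with rfl | hij
      · simp
      · simp [hij, hφ v i (Finset.mem_of_mem_insert_of_ne hi hij)]
    · rw [← ExteriorAlgebra.map_comp_map, AlgHom.comp_toLinearMap, LinearMap.rTensor_comp,
        LinearMap.comp_apply, hfix, rTensor_map_sub_smulRight (hz j)]

theorem exists_eq_one_tmul_of_contraction_eq_zero {ι : Type*} [Finite ι]
    {z : ExteriorAlgebra R (ι → R) ⊗[R] M}
    (hz : ∀ j, (contraction (LinearMap.proj j)).rTensor M z = 0) :
    ∃ m : M, z = 1 ⊗ₜ m := by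
  classical
  have := Fintype.ofFinite ι
  obtain ⟨φ, hφ, hfix⟩ := exists_map_fixes_of_contraction_eq_zero hz Finset.univ
  obtain rfl : φ = 0 := LinearMap.ext fun v => funext fun i => hφ v i (Finset.mem_univ i)
  rw [map_zero_eq_ofId_comp_algebraMapInv] at hfix
  rw [← hfix]
  clear hfix hz
  induction z using TensorProduct.induction_on with
  | zero => exact ⟨0, by simp⟩
  | tmul e m =>
    refine ⟨ExteriorAlgebra.algebraMapInv e • m, ?_⟩
    simp [Algebra.ofId_apply, Algebra.algebraMap_eq_smul_one, TensorProduct.smul_tmul]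
  | add x y hx hy =>
    obtain ⟨m, hm⟩ := hx
    obtain ⟨m', hm'⟩ := hy
    exact ⟨m + m', by rw [map_add, hm, hm', TensorProduct.tmul_add]⟩

end Contraction

/-! ### Koszul differentials -/

section Koszul

variable {R A ι : Type*} [CommRing R] [CommRing A] [Algebra R A] [Fintype ι]

/-- The differential of the Koszul complex of the family `y`: the signed derivation of `E ⊗ A`
with `xⱼ ↦ yⱼ` that kills `A`. -/
def koszul (y : ι → A) : Module.End R (ExteriorAlgebra R (ι → R) ⊗[R] A) :=
  ∑ j, TensorProduct.map (contraction (LinearMap.proj j)) (LinearMap.mulLeft R (y j))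

theorem koszul_tmul (y : ι → A) (e : ExteriorAlgebra R (ι → R)) (a : A) :
    koszul y (e ⊗ₜ[R] a) = ∑ j, contraction (LinearMap.proj j) e ⊗ₜ[R] (y j * a) := by
  simp [koszul, LinearMap.sum_apply]

theorem koszul_add (y y' : ι → A) :
    (koszul (y + y') : Module.End R (ExteriorAlgebra R (ι → R) ⊗[R] A)) =
      koszul y + koszul y' := by
  ext e a
  simp [koszul_tmul, add_mul, TensorProduct.tmul_add, Finset.sum_add_distrib]

theorem koszul_smul (a : A) (y : ι → A) :
    (koszul (a • y) : Module.End R (ExteriorAlgebra R (ι → R) ⊗[R] A)) =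
      (LinearMap.mulLeft R a).lTensor _ ∘ₗ koszul y := by
  ext e b
  simp [koszul_tmul, mul_assoc]

theorem koszul_single [DecidableEq ι] (k : ι) (a : A) :
    (koszul (Pi.single k a) : Module.End R (ExteriorAlgebra R (ι → R) ⊗[R] A)) =
      (LinearMap.mulLeft R a).lTensor _ ∘ₗ (contraction (LinearMap.proj k)).rTensor A := by
  ext e b
  simp [koszul_tmul, Pi.single_apply, ite_mul, apply_ite]

theorem koszul_koszul_self (y : ι → A) (z : ExteriorAlgebra R (ι → R) ⊗[R] A) :
    koszul y (koszul y z) = 0 := by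
  classical
  induction z using TensorProduct.induction_on with
  | zero => simp only [map_zero]
  | add z z' hz hz' => rw [map_add, map_add, hz, hz', add_zero]
  | tmul e a =>
    simp only [koszul_tmul, map_sum]
    rw [← Finset.sum_product']
    refine Finset.sum_involution (fun jl _ => jl.swap) ?_ ?_ (by simp) (by simp)
    · rintro ⟨j, l⟩ -
      rw [Prod.fst_swap, Prod.snd_swap, contraction_comm, TensorProduct.neg_tmul, mul_left_comm,
        neg_add_cancel]
    · rintro ⟨j, l⟩ - hne hjl
      obtain rfl : l = j := congrArg Prod.fst hjl
      exact hne (by rw [contraction_contraction_self, TensorProduct.zero_tmul])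

theorem koszul_anticomm (y y' : ι → A) (z : ExteriorAlgebra R (ι → R) ⊗[R] A) :
    koszul y (koszul y' z) = -koszul y' (koszul y z) := by
  have h := koszul_koszul_self (y + y') z
  simp only [koszul_add, LinearMap.add_apply, map_add, koszul_koszul_self, zero_add, add_zero] at h
  exact eq_neg_of_add_eq_zero_right h

/-- The families `y` whose Koszul differential kills `z`. -/
def koszulAnnihilator (z : ExteriorAlgebra R (ι → R) ⊗[R] A) : Submodule A (ι → A) where
  carrier := {y | koszul y z = 0}
  add_mem' {y y'} hy hy' := by
    change koszul (y + y') z = 0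
    rw [koszul_add, LinearMap.add_apply, hy, hy', add_zero]
  zero_mem' := by simp [koszul]
  smul_mem' a y hy := by
    change koszul (a • y) z = 0
    rw [koszul_smul, LinearMap.comp_apply, hy, map_zero]

theorem single_det_mem_of_row_mem [DecidableEq ι] {N : Submodule A (ι → A)} {B : Matrix ι ι A}
    (hB : ∀ i, B i ∈ N) (k : ι) : Pi.single k B.det ∈ N := by
  have h : Pi.single k B.det = ∑ i, B.adjugate k i • B i := by
    ext j
    have h := congrFun (congrFun B.adjugate_mul k) j
    simpa [Matrix.mul_apply, Pi.single_apply, Matrix.one_apply, eq_comm] using h.symm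
  rw [h]
  exact sum_mem fun i _ => N.smul_mem _ (hB i)

theorem contraction_eq_zero_of_koszul_eq_zero {K : Type*} [Field K] [IsDomain A] [Algebra K A]
    [DecidableEq ι] {B : Matrix ι ι A} (hB : B.det ≠ 0) {z : ExteriorAlgebra K (ι → K) ⊗[K] A}
    (hz : ∀ i, koszul (B i) z = 0) (k : ι) :
    (contraction (LinearMap.proj k)).rTensor A z = 0 := by
  have hk : koszul (Pi.single k B.det) z = 0 :=
    single_det_mem_of_row_mem (N := koszulAnnihilator z) hz k
  have hinj := Module.Flat.lTensor_preserves_injective_linearMap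
    (M := ExteriorAlgebra K (ι → K)) (LinearMap.mulLeft K B.det) (mul_right_injective₀ hB)
  rw [koszul_single] at hk
  exact hinj (hk.trans (map_zero _).symm)

end Koszul

/-! ### Milnor operations -/

theorem exists_mem_ne_zero_forall_apply_eq_zero {R M : Type*} [Ring R] [AddCommGroup M]
    [Module R M] {W : Submodule R M} {T : ℕ → Module.End R M}
    (hanti : ∀ i j x, T i (T j x) = -T j (T i x)) (hsq : ∀ i x, T i (T i x) = 0)
    (hW : ∀ i, ∀ x ∈ W, T i x ∈ W) (hne : W ≠ ⊥) (m : ℕ) :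
    ∃ w ∈ W, w ≠ 0 ∧ ∀ i < m, T i w = 0 := by
  induction m with
  | zero => simpa using W.exists_mem_ne_zero_of_ne_bot hne
  | succ m ih =>
    obtain ⟨w, hw, hw0, hker⟩ := ih
    simp only [Nat.lt_succ_iff_lt_or_eq]
    by_cases h : T m w = 0
    · exact ⟨w, hw, hw0, fun i hi => hi.elim (hker i) fun him => him ▸ h⟩
    · refine ⟨T m w, hW m w hw, h, fun i hi => hi.elim (fun him => ?_) fun him => him ▸ hsq _ w⟩
      rw [hanti, hker i him, map_zero, neg_zero]

section Milnor

variable {p : ℕ} [Fact p.Prime] {n : ℕ}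

variable (p) in
/-- The Milnor primitive `Qᵢ` on `E ⊗ P`: the signed derivation with `xⱼ ↦ yⱼ^(pⁱ)`, `yⱼ ↦ 0`. -/
def milnor (i n : ℕ) : Module.End (ZMod p) (Coh p n) :=
  koszul fun j => X j ^ p ^ i

theorem milnor_zero : milnor p 0 n = bockstein p n := by
  simp [milnor, koszul, bockstein, contraction]

theorem milnor_succ (i : ℕ) (z : Coh p n) :
    milnor p (i + 1) n z =
      power p (p ^ i) n (milnor p i n z) - milnor p i n (power p (p ^ i) n z) := by
  induction z using TensorProduct.induction_on with
  | zero => simp only [map_zero, sub_zero]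
  | add x y hx hy => simp only [map_add, hx, hy]; abel
  | tmul e f =>
    simp only [milnor, koszul_tmul, power, LinearMap.lTensor_tmul, map_sum]
    rw [← Finset.sum_sub_distrib]
    refine Finset.sum_congr rfl fun j _ => ?_
    rw [polyPower_X_pow_mul, TensorProduct.tmul_add, add_sub_cancel_left]

variable {N : Submodule (ZMod p) (Coh p n)}

theorem milnor_mem (hβ : ∀ z ∈ N, bockstein p n z ∈ N) (hP : ∀ k, ∀ z ∈ N, power p k n z ∈ N)
    (i : ℕ) : ∀ z ∈ N, milnor p i n z ∈ N := by
  induction i with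
  | zero => rwa [milnor_zero]
  | succ i ih =>
    intro z hz
    rw [milnor_succ]
    exact N.sub_mem (hP _ _ (ih z hz)) (ih _ (hP _ z hz))

theorem exists_one_tmul_mem (hβ : ∀ z ∈ N, bockstein p n z ∈ N)
    (hP : ∀ k, ∀ z ∈ N, power p k n z ∈ N) (hN : N ≠ ⊥) :
    ∃ f : Poly p n, f ≠ 0 ∧ (1 : Ext p n) ⊗ₜ f ∈ N := by
  obtain ⟨w, hw, hw0, hker⟩ := exists_mem_ne_zero_forall_apply_eq_zero
    (T := fun i => milnor p i n) (fun _ _ => koszul_anticomm _ _) (fun _ => koszul_koszul_self _)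
    (milnor_mem hβ hP) hN n
  have hdet : (mooreMatrix p n fun i : Fin n => (i : ℕ)).det ≠ 0 := mooreDet_ne_zero
  obtain ⟨f, rfl⟩ := exists_eq_one_tmul_of_contraction_eq_zero
    (contraction_eq_zero_of_koszul_eq_zero hdet fun i => hker i i.2)
  exact ⟨f, fun hf => hw0 (by rw [hf, TensorProduct.tmul_zero]), hw⟩

end Milnor

/-! ### Indecomposability -/

theorem isIndecomposable_of_eventually_mem {R M : Type} [Ring R] [AddCommGroup M] [Module R M]
    {L : Submodule R M} {x : ℕ → M} (hxL : ∀ k, x k ∈ L) (hx0 : ∀ k, x k ≠ 0)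
    (hx : ∀ N ≤ L, N ≠ ⊥ → ∀ᶠ k in Filter.atTop, x k ∈ N) : IsIndecomposable R L := by
  have hev (N : Submodule R L) (hN : N ≠ ⊥) : ∀ᶠ k in Filter.atTop, (⟨x k, hxL k⟩ : L) ∈ N := by
    refine (hx (N.map L.subtype) (L.map_subtype_le N) ?_).mono fun k hk => ?_
    · exact ((Submodule.map_injective_of_injective L.subtype_injective).ne_iff'
        (Submodule.map_bot _)).2 hN
    · simpa [hxL k] using hk
  refine ⟨⟨⟨x 0, hxL 0⟩, 0, fun h => hx0 0 (congrArg Subtype.val h)⟩, fun N N' hN => ?_⟩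
  by_contra! hcon
  have hN' : N' ≠ ⊥ := fun h => hcon.2 (by simpa [h] using hN.sup_eq_top)
  obtain ⟨k, hk, hk'⟩ := ((hev N hcon.1).and (hev N' hN')).exists
  exact hx0 k (congrArg Subtype.val (Submodule.disjoint_def.1 hN.disjoint _ hk hk'))

section AugmentationIdeals

variable {p : ℕ} [Fact p.Prime] {n : ℕ}

theorem polyAug_eulerClass_pow (hn : 1 ≤ n) {a : ℕ} (ha : a ≠ 0) :
    polyAug p n (eulerClass p n ^ a) = 0 := by
  have hdvd : (X ⟨0, hn⟩ : Poly p n) ∣ eulerClass p n ^ a :=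
    dvd_pow ((X_dvd_mooreDet _).trans
      (dvd_pow_self _ (Nat.sub_pos_of_lt (Fact.out : p.Prime).one_lt).ne')) ha
  simpa [polyAug] using map_dvd (polyAug p n) hdvd

theorem isIndecomposable_classicalAugmentationIdeal (hn : 1 ≤ n) :
    IsIndecomposable (ReducedPowerAlgebra p) (classicalAugmentationIdeal p n) := by
  have hp := (Fact.out : p.Prime)
  refine isIndecomposable_of_eventually_mem (x := fun k => eulerClass p n ^ p ^ k)
    (fun k => ⟨pow_mem eulerClass_mem_classicalDickson _,
      polyAug_eulerClass_pow hn (pow_pos hp.pos k).ne'⟩)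
    (fun k => pow_ne_zero _ eulerClass_ne_zero) fun N hNL hN => ?_
  obtain ⟨f, hf, hf0⟩ := N.exists_mem_ne_zero_of_ne_bot hN
  have hW : PowerStable (AddSubgroup.toZModSubmodule p N.toAddSubgroup) := fun k g hg =>
    N.smul_mem (⟨polyPower p k, Algebra.subset_adjoin ⟨k, rfl⟩⟩ : ReducedPowerAlgebra p) hg
  exact hW.eventually_eulerClass_pow_mem hn hf (hNL hf).1 hf0 (hNL hf).2

theorem one_tmul_injective : Function.Injective fun f : Poly p n => (1 : Ext p n) ⊗ₜ[ZMod p] f :=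
  Algebra.TensorProduct.includeRight_injective (algebraMap (ZMod p) (Ext p n)).injective

theorem act_one_tmul (g : Matrix (Fin n) (Fin n) (ZMod p)) (f : Poly p n) :
    act p g (1 ⊗ₜ f) = 1 ⊗ₜ polyAct p g f := by
  rw [act, Algebra.TensorProduct.map_tmul, map_one]

theorem one_tmul_mem_extendedDickson_iff {f : Poly p n} :
    (1 : Ext p n) ⊗ₜ f ∈ ExtendedDickson p n ↔ f ∈ ClassicalDickson p n := by
  simp only [mem_extendedDickson, mem_classicalDickson, act_one_tmul, one_tmul_injective.eq_iff]

theorem aug_one_tmul (f : Poly p n) : aug p n (1 ⊗ₜ f) = polyAug p n f := by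
  simp [aug]

theorem one_tmul_mem_extendedAugmentationIdeal_iff {f : Poly p n} :
    (1 : Ext p n) ⊗ₜ f ∈ extendedAugmentationIdeal p n ↔ f ∈ classicalAugmentationIdeal p n :=
  and_congr one_tmul_mem_extendedDickson_iff (by rw [aug_one_tmul])

theorem isIndecomposable_extendedAugmentationIdeal (hn : 1 ≤ n) :
    IsIndecomposable (SteenrodAlgebra p) (extendedAugmentationIdeal p n) := by
  have hp := (Fact.out : p.Prime)
  refine isIndecomposable_of_eventually_mem (x := fun k => 1 ⊗ₜ (eulerClass p n ^ p ^ k))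
    (fun k => one_tmul_mem_extendedAugmentationIdeal_iff.2
      ⟨pow_mem eulerClass_mem_classicalDickson _,
        polyAug_eulerClass_pow hn (pow_pos hp.pos k).ne'⟩)
    (fun k => ?_) fun N hNL hN => ?_
  · rw [← TensorProduct.tmul_zero _ (1 : Ext p n), one_tmul_injective.ne_iff]
    exact pow_ne_zero _ eulerClass_ne_zero
  let V := AddSubgroup.toZModSubmodule p N.toAddSubgroup
  have hV : V ≠ ⊥ := V.ne_bot_iff.2 (N.exists_mem_ne_zero_of_ne_bot hN)
  have hβ : ∀ z ∈ V, bockstein p n z ∈ V := fun z hz => N.smul_mem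
    (⟨bockstein p, Algebra.subset_adjoin (Set.mem_insert _ _)⟩ : SteenrodAlgebra p) hz
  have hP : ∀ k, ∀ z ∈ V, power p k n z ∈ V := fun k z hz => N.smul_mem
    (⟨power p k, Algebra.subset_adjoin (Set.mem_insert_of_mem _ ⟨k, rfl⟩)⟩ : SteenrodAlgebra p) hz
  obtain ⟨f, hf0, hf⟩ := exists_one_tmul_mem hβ hP hV
  have hW : PowerStable (V.comap (TensorProduct.mk (ZMod p) (Ext p n) (Poly p n) 1)) :=
    fun k g hg => hP k _ hg
  obtain ⟨hfD, haug⟩ := one_tmul_mem_extendedAugmentationIdeal_iff.1 (hNL hf)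
  exact hW.eventually_eulerClass_pow_mem hn hf hfD hf0 haug

end AugmentationIdeals

end Dickson

end

theorem mainTheorem4_general (p : ℕ) [Fact p.Prime] (n : ℕ) (hn : 1 ≤ n) :
    Dickson.IsIndecomposable (Dickson.SteenrodAlgebra p) (Dickson.extendedAugmentationIdeal p n) ∧
    Dickson.IsIndecomposable (Dickson.ReducedPowerAlgebra p)
      (Dickson.classicalAugmentationIdeal p n) :=
  ⟨Dickson.isIndecomposable_extendedAugmentationIdeal hn,
    Dickson.isIndecomposable_classicalAugmentationIdeal hn⟩

theorem mainTheorem4 (p : ℕ) [Fact p.Prime] (n : ℕ) (hn : 1 ≤ n) :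
    (p ≠ 2 →
      Dickson.IsIndecomposable (Dickson.SteenrodAlgebra p)
        (Dickson.extendedAugmentationIdeal p n)) ∧
    Dickson.IsIndecomposable (Dickson.ReducedPowerAlgebra p)
      (Dickson.classicalAugmentationIdeal p n) :=
  (mainTheorem4_general p n hn).imp_left fun h _ => h
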